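/- **Setting.** Let $1\le d<\infty$. For a tuple $T=(T_1,\dots,T_d)$ of bounded operators on a complex Hilbert space $H$ and a word $\alpha=\alpha_1\cdots\alpha_n$ in $\{1,\dots,d\}$ put $T_\alpha=T_{\alpha_1}\cdots T_{\alpha_n}$, $|\alpha|=n$. $T$ is a *row contraction* if $\sum_i T_iT_i^*\le 1$; then $D_{*,T}=(1-\sum_i T_iT_i^*)^{1/2}$ on $H$, $D_T=(1-T^*T)^{1/2}$ on $\bigoplus_{i=1}^d H$ (with $T$ read as a row operator $\bigoplus_{i=1}^d H\to H$), and $\mathcal D_{*,T},\mathcal D_T$ are the closures of their ranges. Let $\Gamma=\bigoplus_{n\ge0}(\mathbb C^d)^{\otimes n}$ be the full Fock space, $(e_\alpha)$ its standard orthonormal basis, $e_0$ the vacuum vector, $L_i$ the left creation operators, $P_n$ the orthogonal projection of $\Gamma$ onto $(\mathbb C^d)^{\otimes n}$ and $P_{<n}$ the one onto $\mathbb C\oplus\mathbb C^d\oplus\cdots\oplus(\mathbb C^d)^{\otimes(n-1)}$. The *Poisson kernel* of a row contraction $T$ is $K(T):H\to\Gamma\otimes\mathcal D_{*,T}$, $K(T)h=\sum_\alpha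 e_\alpha\otimes D_{*,T}T_\alpha^*h$. The (Kribs–Popescu) *curvature invariant* and *Euler characteristic* of $T$ are $$\operatorname{curv}T=\lim_{n\to\infty}\frac{\operatorname{trace}[K(T)^*(P_{<n}\otimes 1)K(T)]}{1+d+\cdots+d^{n-1}},\qquad \chi(T)=\lim_{n\to\infty}\frac{\operatorname{rank}[K(T)^*(P_{<n}\otimes 1)K(T)]}{1+d+\cdots+d^{n-1}}.$$ Let $E_i=\begin{pmatrix}C_i&0\\B_i&A_i\end{pmatrix}$ $(i=1,\dots,d)$ on $H_C\oplus H_A$ be a row contraction (a *lifting* of $C$ by $A$), and let $\gamma:\mathcal D_{*,A}\to\mathcal D_C$ be the associated contraction, i.e. the unique contraction with $B^*=D_C\,\gamma\,D_{*,A}$. The lifting is *reduced* if $A$ is completely non-coisometric ($h=0$ is the only vector with $\sum_{|\alpha|=n}\|A_\alpha^*h\|^2=\|h\|^2$ for all $n$) and $\gamma$ is resolving (if $\gamma D_{*,A}A_\alpha^*h=0$ for all $\alpha$, then $D_{*,A}A_\alpha^*h=0$ for all $\alpha$). Let $V^T$ denote the minimal isometric dilation of $T$ on $H\oplus(\Gamma\otimes\mathcal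 D_T)$, $V_i^T(h\oplus x)=T_ih\oplus\big(e_0\otimes D_T(0,\dots,h,\dots,0)+(L_i\otimes1)x\big)$ with $h$ at the $i$-th place. There are a Hilbert space $\mathcal K$, a tuple $Y$ on $\mathcal K$ and a unitary $$W:(H_C\oplus H_A)\oplus(\Gamma\otimes\mathcal D_E)\to\big(H_C\oplus(\Gamma\otimes\mathcal D_C)\big)\oplus\mathcal K$$ with $WV_i^E=(V_i^C\oplus Y_i)W$ for all $i$ and $W|_{H_C}=1$; the *characteristic function* of the lifting is $M_{C,E}=P_{\Gamma\otimes\mathcal D_C}W|_{\Gamma\otimes\mathcal D_E}$. **Theorem.** Let $E$ be a reduced lifting of $C$ by $A$ such that $\gamma$ is an isometry and $\operatorname{rank}D_C<\infty$. Then all the limits involved exist, $\operatorname{curv}A=\lim_n \operatorname{trace}[K(A)^*(P_n\otimes1)K(A)]/d^n$ as well, and, for every choice of $\mathcal K$, $Y$ and $W$ as above, $$\operatorname{curv}A=\operatorname{rank}D_C-\lim_{n\to\infty}\frac{\operatorname{trace}[M_{C,E}M_{C,E}^*(P_n\otimes1)]}{d^n}=\operatorname{rank}D_C-\lim_{n\to\infty}\frac{\operatorname{trace}[M_{C,E}M_{C,E}^*(P_{<n}\otimes1)]}{1+d+\cdots+d^{n-1}},$$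 $$\chi(A)=\lim_{n\to\infty}\frac{\operatorname{rank}[(1-M_{C,E}M_{C,E}^*)(P_{<n}\otimes1)]}{1+d+\cdots+d^{n-1}}.$$ -/

import Mathlib

open Filter Topology ContinuousLinearMap
open scoped InnerProductSpace InnerProduct

universe u v

noncomputable section

namespace RowLifting

/-! ### Row contractions and defect operators -/

section Rows

variable {d : ℕ} {H : Type u} {H' : Type v}
  [NormedAddCommGroup H] [InnerProductSpace ℂ H] [NormedAddCommGroup H'] [InnerProductSpace ℂ H']

/-- The Hilbert direct sum of `d` copies of `H`. -/
abbrev Copies (d : ℕ) (H : Type u) : Type u := PiLp 2 (fun _ : Fin d => H)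

/-- The row operator `(h₁, …, h_d) ↦ ∑ Tᵢ hᵢ` of a tuple `T`. -/
def rowOp (T : Fin d → H →L[ℂ] H') : Copies d H →L[ℂ] H' :=
  ∑ i, T i ∘L PiLp.proj 2 (fun _ : Fin d => H) i

/-- The embedding of `H` as the `i`-th summand of the direct sum of `d` copies of `H`. -/
def inclCopy (i : Fin d) : H →L[ℂ] Copies d H :=
  (PiLp.continuousLinearEquiv 2 ℂ (fun _ : Fin d => H)).symm.toContinuousLinearMap ∘L
    ContinuousLinearMap.single ℂ (fun _ : Fin d => H) i

/-- `T_α = T_{α₁} T_{α₂} ⋯ T_{αₙ}` for a word `α`; the empty word gives the identity. -/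
def wordOp (T : Fin d → H →L[ℂ] H) (α : List (Fin d)) : H →L[ℂ] H := (α.map T).prod

variable [CompleteSpace H]

/-- `T` is a row contraction: `∑ Tᵢ Tᵢ* ≤ 1`. -/
def IsRowContraction (T : Fin d → H →L[ℂ] H) : Prop := (∑ i, T i ∘L (T i)†) ≤ 1

/-- The defect operator `D_T = (1 - T*T)^{1/2}` on the sum of `d` copies of `H`. -/
def defect (T : Fin d → H →L[ℂ] H) : Copies d H →L[ℂ] Copies d H :=
  CFC.sqrt (1 - (rowOp T)† ∘L rowOp T)

/-- The defect operator `D_{*,T} = (1 - ∑ Tᵢ Tᵢ*)^{1/2}` on `H`. -/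
def defectStar (T : Fin d → H →L[ℂ] H) : H →L[ℂ] H :=
  CFC.sqrt (1 - ∑ i, T i ∘L (T i)†)

/-- The defect space `𝒟_T`, the closure of the range of `D_T`. -/
abbrev defectSpace (T : Fin d → H →L[ℂ] H) : Submodule ℂ (Copies d H) :=
  (LinearMap.range (defect T).toLinearMap).topologicalClosure

/-- The defect space `𝒟_{*,T}`, the closure of the range of `D_{*,T}`. -/
abbrev defectStarSpace (T : Fin d → H →L[ℂ] H) : Submodule ℂ H :=
  (LinearMap.range (defectStar T).toLinearMap).topologicalClosure

/-- `D_T` as an operator into `𝒟_T`. -/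
def defectTo (T : Fin d → H →L[ℂ] H) : Copies d H →L[ℂ] defectSpace T :=
  (defect T).codRestrict _ fun x => Submodule.le_topologicalClosure _ ⟨x, rfl⟩

/-- `D_{*,T}` as an operator into `𝒟_{*,T}`. -/
def defectStarTo (T : Fin d → H →L[ℂ] H) : H →L[ℂ] defectStarSpace T :=
  (defectStar T).codRestrict _ fun x => Submodule.le_topologicalClosure _ ⟨x, rfl⟩

end Rows

/-! ### The full Fock space with coefficients -/

section Fock

variable {d : ℕ} {G : Type u} [NormedAddCommGroup G]

/-- The Hilbert space tensor product `Γ(ℂᵈ) ⊗ G` of the full Fock space with `G`. As the words `α`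
index the orthonormal basis `e_α` of `Γ(ℂᵈ)`, this is the space of square summable families
`(g_α)` in `G`, the family `(g_α)` standing for `∑ e_α ⊗ g_α`. -/
def Fock (d : ℕ) (G : Type u) [NormedAddCommGroup G] : Type u :=
  lp (fun _ : List (Fin d) => G) 2

instance : NormedAddCommGroup (Fock d G) :=
  inferInstanceAs (NormedAddCommGroup (lp (fun _ : List (Fin d) => G) 2))

instance [InnerProductSpace ℂ G] : InnerProductSpace ℂ (Fock d G) :=
  inferInstanceAs (InnerProductSpace ℂ (lp (fun _ : List (Fin d) => G) 2))

instance [CompleteSpace G] : CompleteSpace (Fock d G) :=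
  inferInstanceAs (CompleteSpace (lp (fun _ : List (Fin d) => G) 2))

/-- The coefficient family of an element of `Γ(ℂᵈ) ⊗ G`. -/
def Fock.coeff (f : Fock d G) : List (Fin d) → G :=
  (show lp (fun _ : List (Fin d) => G) 2 from f).1

instance : CoeFun (Fock d G) (fun _ => List (Fin d) → G) where
  coe := Fock.coeff

/-- The element of `Γ(ℂᵈ) ⊗ G` with a given square summable coefficient family. -/
def Fock.mk (f : List (Fin d) → G) (hf : Memℓp f 2) : Fock d G :=
  show lp (fun _ : List (Fin d) => G) 2 from ⟨f, hf⟩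

@[simp] lemma Fock.mk_apply (f : List (Fin d) → G) (hf : Memℓp f 2) (α : List (Fin d)) :
    Fock.mk f hf α = f α := rfl

@[ext] lemma Fock.ext {f g : Fock d G} (h : ∀ α, f α = g α) : f = g :=
  Subtype.ext (funext h)

@[simp] lemma Fock.add_apply (f g : Fock d G) (α : List (Fin d)) : (f + g) α = f α + g α := rfl

@[simp] lemma Fock.smul_apply [InnerProductSpace ℂ G] (c : ℂ) (f : Fock d G)
    (α : List (Fin d)) : (c • f) α = c • f α := rfl

lemma Fock.hasSum_inner [InnerProductSpace ℂ G] (f g : Fock d G) :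
    HasSum (fun α => ⟪f α, g α⟫_ℂ) ⟪f, g⟫_ℂ :=
  lp.hasSum_inner (𝕜 := ℂ) (G := fun _ : List (Fin d) => G) f g

lemma memlp_of_le {f : List (Fin d) → G} (c : ℝ)
    (h : ∀ s : Finset (List (Fin d)), ∑ α ∈ s, ‖f α‖ ^ 2 ≤ c) :
    Memℓp f 2 :=
  memℓp_gen' (C := c) fun s => by simpa using h s

lemma sum_sq_le (f : Fock d G) (s : Finset (List (Fin d))) : ∑ α ∈ s, ‖f α‖ ^ 2 ≤ ‖f‖ ^ 2 := by
  have h := lp.sum_rpow_le_norm_rpow (p := 2) (E := fun _ : List (Fin d) => G) (by norm_num) f s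
  simp only [ENNReal.toReal_ofNat, Real.rpow_ofNat] at h
  exact h

lemma norm_le_of_sum {f : Fock d G} {c : ℝ} (hc : 0 ≤ c)
    (h : ∀ s : Finset (List (Fin d)), ∑ α ∈ s, ‖f α‖ ^ 2 ≤ c ^ 2) : ‖f‖ ≤ c :=
  lp.norm_le_of_forall_sum_le (p := 2) (E := fun _ : List (Fin d) => G)
    (by norm_num) hc fun s => by
      simp only [ENNReal.toReal_ofNat, Real.rpow_ofNat]
      exact h s

variable [InnerProductSpace ℂ G]

/-- A linear operator into the Fock space given by its coefficients. -/
def mkFock {X : Type v} [NormedAddCommGroup X] [InnerProductSpace ℂ X]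
    (F : X →ₗ[ℂ] (List (Fin d) → G))
    (hF : ∀ x, ∀ s : Finset (List (Fin d)), ∑ α ∈ s, ‖F x α‖ ^ 2 ≤ ‖x‖ ^ 2) :
    X →L[ℂ] Fock d G :=
  LinearMap.mkContinuous
    { toFun := fun x => Fock.mk (F x) (memlp_of_le _ (hF x))
      map_add' := fun x y => by ext α; exact congrFun (F.map_add x y) α
      map_smul' := fun c x => by ext α; exact congrFun (F.map_smul c x) α } 1 fun x => by
    rw [one_mul]
    exact norm_le_of_sum (norm_nonneg x) (hF x)

@[simp] lemma mkFock_apply {X : Type v} [NormedAddCommGroup X] [InnerProductSpace ℂ X]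
    (F : X →ₗ[ℂ] (List (Fin d) → G)) (hF) (x : X) (α : List (Fin d)) :
    mkFock F hF x α = F x α := rfl

/-- The embedding `g ↦ e₀ ⊗ g`, where `e₀` is the vacuum vector. -/
def vacuum : G →L[ℂ] Fock d G :=
  mkFock
    { toFun := fun g α => match α with
        | [] => g
        | _ :: _ => 0
      map_add' := fun x y => by ext α; cases α <;> simp
      map_smul' := fun c x => by ext α; cases α <;> simp } fun x s => by
    classical
    calc _ ≤ ∑ α ∈ s, if α = [] then ‖x‖ ^ 2 else 0 :=
          Finset.sum_le_sum fun α _ => by cases α <;> simp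
      _ ≤ _ := by rw [Finset.sum_ite_eq']; split_ifs <;> simp

/-- The operator `Lᵢ ⊗ 1`, where `Lᵢ` is the left creation operator `x ↦ eᵢ ⊗ x`. -/
def creation (i : Fin d) : Fock d G →L[ℂ] Fock d G :=
  mkFock
    { toFun := fun f α => match α with
        | [] => 0
        | j :: β => if j = i then f β else 0
      map_add' := fun x y => by
        ext α; rcases α with _ | ⟨j, β⟩ <;> simp; split_ifs <;> simp
      map_smul' := fun c x => by
        ext α; rcases α with _ | ⟨j, β⟩ <;> simp } fun x s => by
    classical
    refine le_trans ?_ (sum_sq_le x (s.image List.tail))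
    rw [← Finset.sum_filter_add_sum_filter_not s (fun α => α.head? = some i)]
    have h0 : ∀ α ∈ s.filter (fun α => ¬ α.head? = some i),
        ‖(match α with
          | [] => 0
          | j :: β => if j = i then x β else 0 : G)‖ ^ 2 = 0 := by
      intro α hα
      rcases α with _ | ⟨j, β⟩
      · simp
      · have : j ≠ i := by simpa using (Finset.mem_filter.mp hα).2
        simp [this]
    refine (add_le_add le_rfl (Finset.sum_eq_zero h0).le).trans ?_
    rw [add_zero]
    have h1 : ∀ α ∈ s.filter (fun α => α.head? = some i),
        ‖(match α with
          | [] => 0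
          | j :: β => if j = i then x β else 0 : G)‖ ^ 2 = ‖x α.tail‖ ^ 2 := by
      intro α hα
      rcases α with _ | ⟨j, β⟩
      · simp at hα
      · have : j = i := by simpa using (Finset.mem_filter.mp hα).2
        simp [this]
    refine (Finset.sum_congr rfl h1).le.trans ?_
    have hinj : Set.InjOn (List.tail : List (Fin d) → List (Fin d))
        (s.filter (fun α => α.head? = some i) : Finset (List (Fin d))) := by
      intro α hα β hβ h
      rcases α with _ | ⟨j, α⟩ <;> rcases β with _ | ⟨k, β⟩ <;> simp_all
    rw [← Finset.sum_image (f := fun α => ‖x α‖ ^ 2) hinj]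
    exact Finset.sum_le_sum_of_subset_of_nonneg
      (Finset.image_subset_image (Finset.filter_subset _ _)) fun _ _ _ => by positivity

open Classical in
/-- The operator `P ⊗ 1`, where `P` is the orthogonal projection of the Fock space onto the closed
span of the `e_α` with `α ∈ S`. -/
def wordProj (S : Set (List (Fin d))) : Fock d G →L[ℂ] Fock d G :=
  mkFock
    { toFun := fun f α => if α ∈ S then f α else 0
      map_add' := fun x y => by ext α; by_cases h : α ∈ S <;> simp [h]
      map_smul' := fun c x => by ext α; by_cases h : α ∈ S <;> simp [h] } fun x s => by
    refine le_trans (Finset.sum_le_sum fun α _ => ?_) (sum_sq_le x s)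
    by_cases h : α ∈ S <;> simp [h]

/-- `P_n ⊗ 1`, with `P_n` the projection of the Fock space onto `(ℂᵈ)^{⊗ n}`. -/
def degProj (n : ℕ) : Fock d G →L[ℂ] Fock d G := wordProj {α | α.length = n}

/-- `P_{<n} ⊗ 1`, with `P_{<n}` the projection of the Fock space onto
`ℂ ⊕ ℂᵈ ⊕ ⋯ ⊕ (ℂᵈ)^{⊗ (n-1)}`, a space of dimension `1 + d + ⋯ + d^{n-1}`. -/
def degLTProj (n : ℕ) : Fock d G →L[ℂ] Fock d G := wordProj {α | α.length < n}

end Fock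

/-! ### The Poisson kernel -/

section Poisson

variable {d : ℕ} {H : Type u} [NormedAddCommGroup H] [InnerProductSpace ℂ H] [CompleteSpace H]

lemma defectStar_sq {T : Fin d → H →L[ℂ] H} (hT : IsRowContraction T) (h : H) :
    ‖defectStar T h‖ ^ 2 + ∑ i, ‖adjoint (T i) h‖ ^ 2 = ‖h‖ ^ 2 := by
  have hpos : (0 : H →L[ℂ] H) ≤ 1 - ∑ i, T i ∘L (T i)† := sub_nonneg.mpr hT
  have hsq : defectStar T * defectStar T = 1 - ∑ i, T i ∘L (T i)† :=
    CFC.sqrt_mul_sqrt_self _ hpos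
  have hsa : IsSelfAdjoint (defectStar T) := (CFC.sqrt_nonneg _).isSelfAdjoint
  have hadj : (defectStar T)† = defectStar T := hsa.adjoint_eq
  have h1 : ⟪defectStar T h, defectStar T h⟫_ℂ = ⟪h, h⟫_ℂ - ∑ i, ⟪adjoint (T i) h, adjoint (T i) h⟫_ℂ := by
    rw [← ContinuousLinearMap.adjoint_inner_right, hadj, ← mul_apply_eq_comp, hsq]
    have h4 : ∀ i, ⟪adjoint (T i) h, adjoint (T i) h⟫_ℂ = ⟪h, T i (adjoint (T i) h)⟫_ℂ :=
      fun i => ContinuousLinearMap.adjoint_inner_left _ _ _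
    simp only [h4]
    simp [inner_sub_right, inner_sum, sum_apply]
  have h2 := congrArg Complex.re h1
  simp only [inner_self_eq_norm_sq_to_K] at h2
  have h3 : ‖defectStar T h‖ ^ 2 = ‖h‖ ^ 2 - ∑ i, ‖adjoint (T i) h‖ ^ 2 := by
    exact_mod_cast h2
  linarith

/-- A finite set of words that contains all words of length less than `n`. -/
def wordsLT (d : ℕ) : ℕ → Finset (List (Fin d))
  | 0 => ∅
  | n + 1 => insert [] ((Finset.univ ×ˢ wordsLT d n).image fun p => p.1 :: p.2)

lemma mem_wordsLT {n : ℕ} : ∀ {α : List (Fin d)}, α.length < n → α ∈ wordsLT d n := by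
  induction n with
  | zero => intro α h; simp at h
  | succ n ih =>
    intro α h
    rcases α with _ | ⟨j, β⟩
    · simp [wordsLT]
    · have : β ∈ wordsLT d n := ih (by simpa using h)
      simp [wordsLT, this]

lemma poisson_sum_wordsLT {T : Fin d → H →L[ℂ] H} (hT : IsRowContraction T) (n : ℕ) :
    ∀ h : H, ∑ α ∈ wordsLT d n, ‖defectStar T (adjoint (wordOp T α) h)‖ ^ 2 ≤ ‖h‖ ^ 2 := by
  induction n with
  | zero => intro h; simp [wordsLT]
  | succ n ih =>
    intro h
    have hw : ∀ i β, adjoint (wordOp T (i :: β)) h = adjoint (wordOp T β) (adjoint (T i) h) := by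
      intro i β
      have : wordOp T (i :: β) = T i ∘L wordOp T β := by
        simp [wordOp, ContinuousLinearMap.mul_def]
      rw [this, ContinuousLinearMap.adjoint_comp]; rfl
    have h0 : adjoint (wordOp T []) h = h := by
      simp [wordOp, ← ContinuousLinearMap.star_eq_adjoint]
    rw [wordsLT, Finset.sum_insert (by simp), Finset.sum_image (by
      rintro ⟨a, b⟩ - ⟨a', b'⟩ - h; simpa using h), Finset.sum_product, h0,
      ← defectStar_sq hT h]
    refine add_le_add le_rfl (Finset.sum_le_sum fun i _ => ?_)
    simp only [hw]
    exact ih _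

lemma poisson_sum {T : Fin d → H →L[ℂ] H} (hT : IsRowContraction T) (h : H)
    (s : Finset (List (Fin d))) :
    ∑ α ∈ s, ‖defectStar T (adjoint (wordOp T α) h)‖ ^ 2 ≤ ‖h‖ ^ 2 := by
  refine le_trans ?_ (poisson_sum_wordsLT hT (s.sup List.length + 1) h)
  exact Finset.sum_le_sum_of_subset_of_nonneg
    (fun α hα => mem_wordsLT (Nat.lt_succ_of_le (Finset.le_sup (f := List.length) hα)))
    fun _ _ _ => by positivity

open Classical in
/-- The Poisson kernel `K(T) : H → Γ(ℂᵈ) ⊗ 𝒟_{*,T}`, `h ↦ ∑ e_α ⊗ D_{*,T} T_α* h`, of a row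
contraction `T` (and `0` when `T` is not a row contraction). -/
def rowPoissonKernel (T : Fin d → H →L[ℂ] H) : H →L[ℂ] Fock d (defectStarSpace T) :=
  if hT : IsRowContraction T then
    mkFock
      { toFun := fun h α => defectStarTo T (adjoint (wordOp T α) h)
        map_add' := fun x y => by ext α; simp
        map_smul' := fun c x => by ext α; simp } fun h s => poisson_sum hT h s
  else 0

end Poisson

/-! ### Trace, rank, curvature and Euler characteristic -/

section Invariants

/-- The trace `∑ ⟨b, S b⟩` of an operator on a Hilbert space, over an orthonormal basis `b`. -/
def opTrace {H : Type u} [NormedAddCommGroup H] [InnerProductSpace ℂ H] [CompleteSpace H]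
    (S : H →L[ℂ] H) : ℂ :=
  ∑' b : (exists_hilbertBasis ℂ H).choose, ⟪(b : H), S b⟫_ℂ

/-- The rank of an operator (used for operators of finite rank). -/
def opRank {H : Type u} [NormedAddCommGroup H] [InnerProductSpace ℂ H] (S : H →L[ℂ] H) : ℕ :=
  Module.finrank ℂ (LinearMap.range S.toLinearMap)

variable {d : ℕ} {H : Type u} [NormedAddCommGroup H] [InnerProductSpace ℂ H] [CompleteSpace H]

/-- `1 + d + ⋯ + d^{n-1}`. -/
def geomSum (d n : ℕ) : ℕ := ∑ k ∈ Finset.range n, d ^ k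

/-- The Kribs–Popescu curvature invariant of a row contraction `T`,
`lim trace[K(T)* (P_{<n} ⊗ 1) K(T)] / (1 + d + ⋯ + d^{n-1})`. -/
def curvature (T : Fin d → H →L[ℂ] H) : ℝ :=
  limUnder atTop fun n : ℕ =>
    (opTrace ((rowPoissonKernel T)† ∘L degLTProj n ∘L rowPoissonKernel T)).re / (geomSum d n : ℝ)

/-- The Euler characteristic of a row contraction `T`,
`lim rank[K(T)* (P_{<n} ⊗ 1) K(T)] / (1 + d + ⋯ + d^{n-1})`. -/
def eulerChar (T : Fin d → H →L[ℂ] H) : ℝ :=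
  limUnder atTop fun n : ℕ =>
    (opRank ((rowPoissonKernel T)† ∘L degLTProj n ∘L rowPoissonKernel T) : ℝ) / (geomSum d n : ℝ)

end Invariants

/-! ### The minimal isometric dilation -/

section Dilation

variable {d : ℕ} {H : Type u} [NormedAddCommGroup H] [InnerProductSpace ℂ H] [CompleteSpace H]

/-- The space `H ⊕ (Γ(ℂᵈ) ⊗ 𝒟_T)` of the minimal isometric dilation of `T`. -/
abbrev MidSpace (T : Fin d → H →L[ℂ] H) : Type u := WithLp 2 (H × Fock d (defectSpace T))

/-- The minimal isometric dilation of `T` in Popescu's form,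
`Vᵢ (h ⊕ x) = Tᵢ h ⊕ (e₀ ⊗ D_T (0, …, h, …, 0) + (Lᵢ ⊗ 1) x)`, with `h` at the `i`-th place. -/
def mid (T : Fin d → H →L[ℂ] H) (i : Fin d) : MidSpace T →L[ℂ] MidSpace T :=
  (WithLp.prodContinuousLinearEquiv 2 ℂ H (Fock d (defectSpace T))).symm.toContinuousLinearMap ∘L
    (ContinuousLinearMap.prod
      (T i ∘L ContinuousLinearMap.fst ℂ H (Fock d (defectSpace T)))
      ((vacuum ∘L defectTo T ∘L inclCopy i) ∘L
          ContinuousLinearMap.fst ℂ H (Fock d (defectSpace T)) +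
        creation i ∘L ContinuousLinearMap.snd ℂ H (Fock d (defectSpace T)))) ∘L
    (WithLp.prodContinuousLinearEquiv 2 ℂ H (Fock d (defectSpace T))).toContinuousLinearMap

end Dilation

/-! ### Liftings and their characteristic functions -/

section Lifting

variable {d : ℕ} {HC HA : Type u}
  [NormedAddCommGroup HC] [InnerProductSpace ℂ HC] [CompleteSpace HC]
  [NormedAddCommGroup HA] [InnerProductSpace ℂ HA] [CompleteSpace HA]

/-- The tuple `E` on `H_C ⊕ H_A` with the block matrices `Eᵢ = (Cᵢ 0; Bᵢ Aᵢ)`. -/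
def blockTuple (C : Fin d → HC →L[ℂ] HC) (B : Fin d → HC →L[ℂ] HA) (A : Fin d → HA →L[ℂ] HA)
    (i : Fin d) : WithLp 2 (HC × HA) →L[ℂ] WithLp 2 (HC × HA) :=
  (WithLp.prodContinuousLinearEquiv 2 ℂ HC HA).symm.toContinuousLinearMap ∘L
    (ContinuousLinearMap.prod
      (C i ∘L ContinuousLinearMap.fst ℂ HC HA)
      (B i ∘L ContinuousLinearMap.fst ℂ HC HA + A i ∘L ContinuousLinearMap.snd ℂ HC HA)) ∘L
    (WithLp.prodContinuousLinearEquiv 2 ℂ HC HA).toContinuousLinearMap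

/-- `γ : 𝒟_{*,A} → 𝒟_C` is the contraction that belongs to the lifting: `B* = D_C γ D_{*,A}`, with
`B` the row operator of the tuple `(Bᵢ)`. There is at most one such `γ`, since `D_C` is injective
on `𝒟_C` and the range of `D_{*,A}` is dense in `𝒟_{*,A}`. -/
def IsLiftingContraction (C : Fin d → HC →L[ℂ] HC) (B : Fin d → HC →L[ℂ] HA)
    (A : Fin d → HA →L[ℂ] HA) (γ : defectStarSpace A →L[ℂ] defectSpace C) : Prop :=
  (∀ x, ‖γ x‖ ≤ ‖x‖) ∧ ∀ h : HA, adjoint (rowOp B) h = defect C (γ (defectStarTo A h))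

/-- `A` is completely non-coisometric: `0` is the only `h` with `∑_{|α| = n} ‖A_α* h‖² = ‖h‖²` for
all `n`. -/
def IsCNC (A : Fin d → HA →L[ℂ] HA) : Prop :=
  ∀ h : HA, (∀ n : ℕ, ∑ w : Fin n → Fin d, ‖adjoint (wordOp A (List.ofFn w)) h‖ ^ 2 = ‖h‖ ^ 2) → h = 0

/-- `γ` is resolving: if `γ D_{*,A} A_α* h = 0` for all `α`, then `D_{*,A} A_α* h = 0` for
all `α`. -/
def IsResolving (C : Fin d → HC →L[ℂ] HC) (A : Fin d → HA →L[ℂ] HA)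
    (γ : defectStarSpace A →L[ℂ] defectSpace C) : Prop :=
  ∀ h : HA, (∀ α, γ (defectStarTo A (adjoint (wordOp A α) h)) = 0) →
    ∀ α, defectStarTo A (adjoint (wordOp A α) h) = 0

/-- The tuple `E = (C 0; B A)` is a reduced lifting of `C` by `A`, with associated contraction `γ`:
`E` is a row contraction, `A` is completely non-coisometric and `γ` is resolving. -/
structure IsReducedLifting (C : Fin d → HC →L[ℂ] HC) (B : Fin d → HC →L[ℂ] HA)
    (A : Fin d → HA →L[ℂ] HA) (γ : defectStarSpace A →L[ℂ] defectSpace C) : Prop where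
  rowContraction : IsRowContraction (blockTuple C B A)
  contraction : IsLiftingContraction C B A γ
  cnc : IsCNC A
  resolving : IsResolving C A γ

/-- A splitting of the minimal isometric dilation `Vᴱ` of the lifting `E` along the minimal
isometric dilation `Vᶜ` of `C`: a tuple `Y` on `K` and a unitary
`W : H_E ⊕ (Γ ⊗ 𝒟_E) → (H_C ⊕ (Γ ⊗ 𝒟_C)) ⊕ K` with `(Vᶜᵢ ⊕ Yᵢ) W = W Vᴱᵢ` for all `i`, which is
the identity on `H_C`. -/
structure DilationSplitting (C : Fin d → HC →L[ℂ] HC) (B : Fin d → HC →L[ℂ] HA)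
    (A : Fin d → HA →L[ℂ] HA) (K : Type v) [NormedAddCommGroup K] [InnerProductSpace ℂ K] where
  W : MidSpace (blockTuple C B A) ≃ₗᵢ[ℂ] WithLp 2 (MidSpace C × K)
  Y : Fin d → K →L[ℂ] K
  intertwines : ∀ i x, W (mid (blockTuple C B A) i x) =
    WithLp.toLp 2 (mid C i (W x).fst, Y i (W x).snd)
  fixes : ∀ h : HC, W (WithLp.toLp 2 (WithLp.toLp 2 (h, (0 : HA)), 0)) =
    WithLp.toLp 2 (WithLp.toLp 2 (h, 0), 0)

/-- The characteristic function `M_{C,E} = P_{Γ ⊗ 𝒟_C} W|_{Γ ⊗ 𝒟_E}` of the lifting. -/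
def DilationSplitting.charFun {C : Fin d → HC →L[ℂ] HC} {B : Fin d → HC →L[ℂ] HA}
    {A : Fin d → HA →L[ℂ] HA} {K : Type v} [NormedAddCommGroup K] [InnerProductSpace ℂ K]
    (S : DilationSplitting C B A K) :
    Fock d (defectSpace (blockTuple C B A)) →L[ℂ] Fock d (defectSpace C) :=
  WithLp.sndL 2 ℂ HC (Fock d (defectSpace C)) ∘L WithLp.fstL 2 ℂ (MidSpace C) K ∘L
    S.W.toContinuousLinearEquiv.toContinuousLinearMap ∘L
    (WithLp.prodContinuousLinearEquiv 2 ℂ (WithLp 2 (HC × HA))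
      (Fock d (defectSpace (blockTuple C B A)))).symm.toContinuousLinearMap ∘L
    ContinuousLinearMap.inr ℂ (WithLp 2 (HC × HA)) (Fock d (defectSpace (blockTuple C B A)))

end Lifting

end RowLifting

end

/-! Everything reduces to the operator J = P_{Γ⊗𝒟_C} W|_{H_A} (`DilationSplitting.poisson`). Since W
is unitary and fixes H_C, pulling Γ ⊗ 𝒟_C back along W meets only H_A and Γ ⊗ 𝒟_E. Hence M M* + J J*
= 1 (`charFun_comp_adjoint`). The intertwining relation gives J*(L_i ⊗ 1) = A_i J* and J*(e₀ ⊗ x) =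
D_{*,A} γ* x, so J h = ∑ e_α ⊗ γ D_{*,A} A_α* h, that is, J = (1 ⊗ γ) K(A)
(`poisson_isPoissonType`).

Both J and K(A) thus have coefficients X* A_α* h, with X = D_{*,A} γ* and X = D_{*,A} respectively.
For such an operator the trace in degree n is ∑_{|α|=n} ‖A_α X‖₂², and the rank below degree n is
the dimension of the span M_n of the spaces A_α ran X, |α| < n. As γ is isometric, γ* is onto and
γ*γ = 1, so both choices of X give the same numbers. The trace of M M*(P_n ⊗ 1) is then rank D_C ·
dⁿ minus the trace for K(A). For the rank, 1 - M M* = J J*, and J is injective because A is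
completely non-coisometric and γ is injective.

The limits exist because the traces by degree, and the increments dim M_{n+1} - dim M_n, grow at
most by the factor d in each step. Their quotients by dⁿ decrease, and a Stolz–Cesàro argument
passes to the averages with weights d^k.

A splitting W exists because the dilation of E is an isometric dilation of C, and the minimal one
embeds in it as a reducing subspace (`exists_embedding`). -/

noncomputable section

namespace RowLifting

/-! ### Averages with geometric weights -/

lemma tendsto_sum_div_geomSum {𝕜 : Type*} [RCLike 𝕜] {d : ℕ} (hd : 0 < d) {c : ℕ → 𝕜} {l : 𝕜}
    (hc : Tendsto (fun n => c n / (d : 𝕜) ^ n) atTop (𝓝 l)) :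
    Tendsto (fun n => (∑ k ∈ Finset.range n, c k) / (geomSum d n : 𝕜)) atTop (𝓝 l) := by
  have hd0 : (d : 𝕜) ≠ 0 := by exact_mod_cast hd.ne'
  -- Stolz–Cesàro: the error is o(dⁿ), and partial sums preserve this relation because ∑ d^k
  -- diverges, also for d = 1.
  have hlo : (fun n => c n - l * (d : 𝕜) ^ n) =o[atTop] fun n => (d : ℝ) ^ n := by
    rw [← Asymptotics.isLittleO_norm_right]
    have h1 : (fun n => ‖(d : ℝ) ^ n‖) = fun n => ‖(d : 𝕜) ^ n‖ := by
      funext n; simp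
    rw [h1, Asymptotics.isLittleO_norm_right, Asymptotics.isLittleO_iff_tendsto fun n h =>
      absurd h (pow_ne_zero _ hd0)]
    have h2 := hc.sub_const l
    rw [sub_self] at h2
    refine h2.congr fun n => ?_
    field_simp
  have htop : Tendsto (fun n => ∑ k ∈ Finset.range n, (d : ℝ) ^ k) atTop atTop := by
    refine tendsto_atTop_mono (fun n => ?_) tendsto_natCast_atTop_atTop
    calc (n : ℝ) = ∑ k ∈ Finset.range n, (1 : ℝ) := by simp
      _ ≤ _ := Finset.sum_le_sum fun k _ => one_le_pow₀ (by exact_mod_cast hd)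
  have h3 := hlo.sum_range (fun n => by positivity) htop
  have hg : ∀ n, ((geomSum d n : ℕ) : 𝕜) = ∑ k ∈ Finset.range n, (d : 𝕜) ^ k := by
    intro n; simp [geomSum]
  have hgR : ∀ n, ∑ k ∈ Finset.range n, (d : ℝ) ^ k = ‖((geomSum d n : ℕ) : 𝕜)‖ := by
    intro n; rw [RCLike.norm_natCast]; simp [geomSum]
  have hgpos : ∀ᶠ n in atTop, ((geomSum d n : ℕ) : 𝕜) ≠ 0 := by
    filter_upwards [htop.eventually_gt_atTop 0] with n hn
    rw [hgR] at hn
    exact norm_pos_iff.mp hn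
  simp only [hgR] at h3
  rw [Asymptotics.isLittleO_norm_right, Asymptotics.isLittleO_iff_tendsto'
    (hgpos.mono fun n h h' => absurd h' h)] at h3
  have h4 := h3.add_const l
  rw [zero_add] at h4
  refine h4.congr' (hgpos.mono fun n h => ?_)
  rw [Finset.sum_sub_distrib, ← Finset.mul_sum, ← hg]
  field_simp
  ring

/-- The quotients are nonincreasing and bounded below by 0. Applied to traces by degree and to
dimension increments. -/
lemma exists_tendsto_div_pow {d : ℕ} (hd : 0 < d) {c : ℕ → ℝ} (h0 : ∀ n, 0 ≤ c n)
    (hc : ∀ n, c (n + 1) ≤ d * c n) :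
    ∃ l, Tendsto (fun n => c n / (d : ℝ) ^ n) atTop (𝓝 l) := by
  have hd0 : (0 : ℝ) < d := by exact_mod_cast hd
  have hanti : Antitone fun n => c n / (d : ℝ) ^ n := by
    refine antitone_nat_of_succ_le fun n => ?_
    rw [div_le_div_iff₀ (by positivity) (by positivity), pow_succ]
    nlinarith [hc n, pow_pos hd0 n]
  exact ⟨_, tendsto_atTop_ciInf hanti ⟨0, by rintro _ ⟨n, rfl⟩; have := h0 n; positivity⟩⟩

/-! ### Traces of operators that factor through a finite dimensional space -/

section Trace

variable {G : Type*} {H : Type*} {H' : Type*}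
  [NormedAddCommGroup G] [InnerProductSpace ℂ G] [CompleteSpace G] [FiniteDimensional ℂ G]
  [NormedAddCommGroup H] [InnerProductSpace ℂ H]
  [NormedAddCommGroup H'] [InnerProductSpace ℂ H']

/-- The index set of the orthonormal basis that enters `opTrace`. -/
abbrev traceBasisSet (H : Type*) [NormedAddCommGroup H] [InnerProductSpace ℂ H] [CompleteSpace H] :
    Set H := (exists_hilbertBasis ℂ H).choose

/-- The orthonormal basis that enters `opTrace`. -/
def traceBasis (H : Type*) [NormedAddCommGroup H] [InnerProductSpace ℂ H] [CompleteSpace H] :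
    HilbertBasis (traceBasisSet H) ℂ H := (exists_hilbertBasis ℂ H).choose_spec.choose

lemma traceBasis_apply [CompleteSpace H] (b : traceBasisSet H) : traceBasis H b = (b : H) :=
  congrFun (exists_hilbertBasis ℂ H).choose_spec.choose_spec b

instance : Finite (traceBasisSet G) :=
  ((traceBasis G).orthonormal.linearIndependent).finite

instance : Fintype (traceBasisSet G) := Fintype.ofFinite _

lemma opTrace_eq_sum (S : G →L[ℂ] G) : opTrace S = ∑ c : traceBasisSet G, ⟪(c : G), S c⟫_ℂ :=
  tsum_fintype _

/-- The squared Hilbert–Schmidt norm of an operator on a finite dimensional space. -/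
def hsNormSq (Z : G →L[ℂ] H) : ℝ := ∑ c : traceBasisSet G, ‖Z c‖ ^ 2

lemma hsNormSq_nonneg (Z : G →L[ℂ] H) : 0 ≤ hsNormSq Z :=
  Finset.sum_nonneg fun _ _ => by positivity

lemma hsNormSq_comp_le {S : H →L[ℂ] H'} (hS : ‖S‖ ≤ 1) (Z : G →L[ℂ] H) :
    hsNormSq (S ∘L Z) ≤ hsNormSq Z := by
  refine Finset.sum_le_sum fun c _ => ?_
  have := S.le_of_opNorm_le hS (Z c)
  rw [one_mul] at this
  exact pow_le_pow_left₀ (norm_nonneg _) this 2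

variable [CompleteSpace H]

/-- Parseval in H for each of the finitely many basis vectors of G, then Parseval in G: only a
finite sum is exchanged with the infinite one. This gives cyclicity together with summability, which
`opTrace`, being a `tsum`, needs on infinite-dimensional spaces. -/
lemma hasSum_opTrace (X : G →L[ℂ] H) (Y : H →L[ℂ] G) :
    HasSum (fun b : traceBasisSet H => ⟪(b : H), (X ∘L Y) b⟫_ℂ) (opTrace (Y ∘L X)) := by
  have h1 : ∀ c : traceBasisSet G, HasSum (fun b : traceBasisSet H =>
      ⟪(c : G), Y b⟫_ℂ * ⟪(b : H), X c⟫_ℂ) ⟪(c : G), Y (X c)⟫_ℂ := by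
    intro c
    have := (traceBasis H).hasSum_inner_mul_inner (adjoint Y c) (X c)
    simpa only [traceBasis_apply, adjoint_inner_left] using this
  rw [opTrace_eq_sum]
  refine (hasSum_sum (s := Finset.univ) fun c _ => h1 c).congr_fun ?_
  intro b
  have := (traceBasis G).hasSum_inner_mul_inner (adjoint X b) (Y b)
  simp only [traceBasis_apply, adjoint_inner_left] at this
  rw [show (X ∘L Y) (b : H) = X (Y b) from rfl, ← this.tsum_eq, tsum_fintype]
  exact Finset.sum_congr rfl fun c _ => mul_comm _ _

lemma opTrace_sum_comp {ι : Type*} (s : Finset ι) (X : ι → G →L[ℂ] H) (Y : ι → H →L[ℂ] G) :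
    opTrace (∑ i ∈ s, X i ∘L Y i) = ∑ i ∈ s, opTrace (Y i ∘L X i) := by
  refine (((hasSum_sum (s := s) fun i _ => hasSum_opTrace (X i) (Y i))).congr_fun ?_).tsum_eq
  intro b
  simp [sum_apply]

lemma opTrace_comp_comm (X : G →L[ℂ] H) (Y : H →L[ℂ] G) : opTrace (X ∘L Y) = opTrace (Y ∘L X) :=
  (hasSum_opTrace X Y).tsum_eq

lemma opTrace_sub (S T : G →L[ℂ] G) : opTrace (S - T) = opTrace S - opTrace T := by
  simp [opTrace_eq_sum]

lemma opTrace_one : opTrace (1 : G →L[ℂ] G) = Module.finrank ℂ G := by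
  rw [opTrace_eq_sum, Module.finrank_eq_card_basis (traceBasis G).toOrthonormalBasis.toBasis]
  have : ∀ c : traceBasisSet G, ⟪(c : G), (1 : G →L[ℂ] G) c⟫_ℂ = 1 := by
    intro c
    rw [one_apply_eq_self, ← traceBasis_apply, inner_self_eq_norm_sq_to_K,
      (traceBasis G).orthonormal.1]
    simp
  simp only [this]
  simp

lemma opTrace_adjoint_comp_self (Z : G →L[ℂ] H) : opTrace (Z† ∘L Z) = (hsNormSq Z : ℂ) := by
  rw [opTrace_eq_sum, hsNormSq, Complex.ofReal_sum]
  refine Finset.sum_congr rfl fun c _ => ?_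
  rw [comp_apply, adjoint_inner_right, inner_self_eq_norm_sq_to_K]
  simp

/-- Cyclicity of the trace: tr(V Z*Z V*) = tr(Z*Z V*V). Used with V = γ to remove γ from the traces.
-/
lemma hsNormSq_comp_adjoint {G' : Type*} [NormedAddCommGroup G'] [InnerProductSpace ℂ G']
    [CompleteSpace G'] [FiniteDimensional ℂ G'] {V : G →L[ℂ] G'} (hV : V† ∘L V = 1)
    (Z : G →L[ℂ] H) : hsNormSq (Z ∘L V†) = hsNormSq Z := by
  have h : (hsNormSq (Z ∘L V†) : ℂ) = hsNormSq Z := by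
    rw [← opTrace_adjoint_comp_self, ← opTrace_adjoint_comp_self, adjoint_comp, adjoint_adjoint,
      comp_assoc, opTrace_comp_comm, comp_assoc, comp_assoc, hV]
    rfl
  exact_mod_cast h

end Trace

/-! ### Elementary tensors and projections in the Fock space -/

section Fock

variable {d : ℕ} {G : Type u} [NormedAddCommGroup G] [InnerProductSpace ℂ G]

/-- The operator `g ↦ e_α ⊗ g`. -/
def wordTensor : List (Fin d) → G →L[ℂ] Fock d G
  | [] => vacuum
  | i :: α => creation i ∘L wordTensor α

@[simp] lemma vacuum_nil (g : G) : (vacuum g : Fock d G) [] = g := rfl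

@[simp] lemma vacuum_cons (g : G) (i : Fin d) (α : List (Fin d)) :
    (vacuum g : Fock d G) (i :: α) = 0 := rfl

@[simp] lemma creation_nil (i : Fin d) (f : Fock d G) : creation i f [] = 0 := rfl

@[simp] lemma creation_cons (i j : Fin d) (f : Fock d G) (α : List (Fin d)) :
    creation i f (j :: α) = if j = i then f α else 0 := rfl

lemma wordTensor_apply (α : List (Fin d)) (g : G) (β : List (Fin d)) :
    wordTensor α g β = if β = α then g else 0 := by
  induction α generalizing β with
  | nil => cases β <;> simp [wordTensor]
  | cons i α ih =>
    rcases β with _ | ⟨j, β⟩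
    · simp [wordTensor]
    · by_cases hj : j = i <;> simp [wordTensor, ih, hj]

open Classical in
@[simp] lemma wordProj_apply (S : Set (List (Fin d))) (f : Fock d G) (α : List (Fin d)) :
    wordProj S f α = if α ∈ S then f α else 0 := rfl

lemma inner_wordTensor (α : List (Fin d)) (g : G) (f : Fock d G) :
    ⟪wordTensor α g, f⟫_ℂ = ⟪g, f α⟫_ℂ := by
  refine (Fock.hasSum_inner (wordTensor α g) f).unique ?_
  convert hasSum_single α ?_ using 1
  · simp [wordTensor_apply]
  · intro β hβ
    simp [wordTensor_apply, hβ]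

lemma wordTensor_eq_single [DecidableEq (List (Fin d))] (α : List (Fin d)) (g : G) :
    wordTensor α g = (lp.single 2 α g : lp (fun _ : List (Fin d) => G) 2) := by
  ext β
  rw [wordTensor_apply]
  change _ = (lp.single 2 α g : lp (fun _ : List (Fin d) => G) 2) β
  rw [lp.single_apply]
  by_cases h : β = α
  · subst h; simp
  · simp [h]

lemma hasSum_wordTensor (f : Fock d G) : HasSum (fun α => wordTensor α (f α)) f := by
  classical
  simp only [wordTensor_eq_single]
  exact lp.hasSum_single (p := 2) (E := fun _ : List (Fin d) => G) (by norm_num) f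

lemma clm_ext_wordTensor {X : Type*} [NormedAddCommGroup X] [InnerProductSpace ℂ X]
    {S T : Fock d G →L[ℂ] X} (h : ∀ α g, S (wordTensor α g) = T (wordTensor α g)) : S = T := by
  ext f
  have hS := S.hasSum (hasSum_wordTensor f)
  simp only [h] at hS
  exact hS.unique (T.hasSum (hasSum_wordTensor f))

/-- The finite set of words of length `n`. -/
def wordsOfLength (d : ℕ) : ℕ → Finset (List (Fin d))
  | 0 => {[]}
  | n + 1 => (Finset.univ ×ˢ wordsOfLength d n).image fun p => p.1 :: p.2

@[simp] lemma mem_wordsOfLength {n : ℕ} : ∀ {α : List (Fin d)},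
    α ∈ wordsOfLength d n ↔ α.length = n := by
  induction n with
  | zero => intro α; simp [wordsOfLength]
  | succ n ih =>
    intro α
    rcases α with _ | ⟨j, β⟩ <;> simp [wordsOfLength, ih]

lemma sum_wordsOfLength_succ {M : Type*} [AddCommMonoid M] (n : ℕ) (f : List (Fin d) → M) :
    ∑ α ∈ wordsOfLength d (n + 1), f α = ∑ i, ∑ α ∈ wordsOfLength d n, f (i :: α) := by
  rw [wordsOfLength, Finset.sum_image (by rintro ⟨a, b⟩ - ⟨a', b'⟩ - h; simpa using h),
    Finset.sum_product]

lemma card_wordsOfLength (n : ℕ) : (wordsOfLength d n).card = d ^ n := by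
  induction n with
  | zero => simp [wordsOfLength]
  | succ n ih =>
    have := sum_wordsOfLength_succ (d := d) n fun _ => 1
    rw [Finset.card_eq_sum_ones, this]
    simp [ih, pow_succ, mul_comm]

lemma sum_ofFn {M : Type*} [AddCommMonoid M] (n : ℕ) (f : List (Fin d) → M) :
    ∑ w : Fin n → Fin d, f (List.ofFn w) = ∑ α ∈ wordsOfLength d n, f α := by
  refine Finset.sum_nbij List.ofFn (fun w _ => by simp) (fun w _ w' _ h => List.ofFn_injective h)
    (fun α hα => ?_) fun _ _ => rfl
  have hα' : α.length = n := by simpa using hα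
  subst hα'
  exact ⟨α.get, by simp, List.ofFn_get α⟩

lemma degLTProj_eq_sum (n : ℕ) : (degLTProj n : Fock d G →L[ℂ] Fock d G) =
    ∑ k ∈ Finset.range n, degProj k := by
  refine clm_ext_wordTensor fun β g => ?_
  have h : ∀ S : Set (List (Fin d)), wordProj S (wordTensor β g) =
      S.indicator (fun β => wordTensor β g) β := by
    classical
    intro S
    ext α
    by_cases h : α = β
    · subst h
      by_cases h' : α ∈ S <;> simp [h']
      rfl
    · by_cases h' : β ∈ S <;> simp [h, h', wordTensor_apply]
      rfl
  classical
  simp [degLTProj, degProj, sum_apply, h, Set.indicator_apply]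

variable [CompleteSpace G]

lemma adjoint_wordTensor (α : List (Fin d)) (f : Fock d G) :
    adjoint (wordTensor α : G →L[ℂ] Fock d G) f = f α := by
  refine ext_inner_left ℂ fun g => ?_
  rw [adjoint_inner_right, inner_wordTensor]

lemma degProj_eq_sum (n : ℕ) : (degProj n : Fock d G →L[ℂ] Fock d G) =
    ∑ α ∈ wordsOfLength d n, wordTensor α ∘L (wordTensor α)† := by
  refine clm_ext_wordTensor fun β g => ?_
  simp only [sum_apply, comp_apply, adjoint_wordTensor, wordTensor_apply]
  have h (γ : List (Fin d)) : wordTensor γ (if γ = β then g else 0) =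
      if γ = β then wordTensor β g else 0 := by
    split_ifs with h <;> simp [h]
  simp only [h, Finset.sum_ite_eq']
  ext α
  simp only [degProj, wordProj_apply, wordTensor_apply, mem_wordsOfLength, Set.mem_ofPred_eq]
  by_cases h : α = β
  · subst h
    by_cases h' : α.length = n <;> simp [h', wordTensor_apply]
    rfl
  · by_cases h' : β.length = n <;> simp [h, h', wordTensor_apply]
    rfl

end Fock

/-! ### Operators of Poisson type -/

section PoissonType

variable {d : ℕ} {H : Type*} [NormedAddCommGroup H] [InnerProductSpace ℂ H]

@[simp] lemma wordOp_nil (T : Fin d → H →L[ℂ] H) : wordOp T [] = 1 := rfl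

@[simp] lemma wordOp_cons (T : Fin d → H →L[ℂ] H) (i : Fin d) (α : List (Fin d)) :
    wordOp T (i :: α) = T i ∘L wordOp T α := by
  simp [wordOp, ContinuousLinearMap.mul_def]

/-- The span of the subspaces `T_α R` with `|α| < n`. -/
def wordSpan (T : Fin d → H →L[ℂ] H) (R : Submodule ℂ H) (n : ℕ) : Submodule ℂ H :=
  ⨆ α : {α : List (Fin d) // α.length < n}, R.map (wordOp T α).toLinearMap

lemma map_le_wordSpan (T : Fin d → H →L[ℂ] H) (R : Submodule ℂ H) {n : ℕ} {α : List (Fin d)}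
    (h : α.length < n) : R.map (wordOp T α).toLinearMap ≤ wordSpan T R n :=
  le_iSup (fun α : {α : List (Fin d) // α.length < n} => R.map (wordOp T α).toLinearMap) ⟨α, h⟩

lemma wordSpan_zero (T : Fin d → H →L[ℂ] H) (R : Submodule ℂ H) : wordSpan T R 0 = ⊥ := by
  rw [wordSpan, iSup_eq_bot]
  rintro ⟨α, h⟩
  exact absurd h (Nat.not_lt_zero _)

lemma wordSpan_mono (T : Fin d → H →L[ℂ] H) (R : Submodule ℂ H) : Monotone (wordSpan T R) :=
  fun _ _ hmn => iSup_le fun α => map_le_wordSpan T R (α.2.trans_le hmn)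

lemma wordSpan_succ (T : Fin d → H →L[ℂ] H) (R : Submodule ℂ H) (n : ℕ) :
    wordSpan T R (n + 1) = R ⊔ ⨆ i, (wordSpan T R n).map (T i).toLinearMap := by
  apply le_antisymm
  · refine iSup_le ?_
    rintro ⟨_ | ⟨i, α⟩, h⟩
    · refine le_sup_of_le_left ?_
      rintro _ ⟨x, hx, rfl⟩
      exact hx
    · refine le_sup_of_le_right (le_iSup_of_le i ?_)
      have h' : α.length < n := by simpa using h
      refine le_trans ?_ (Submodule.map_mono (map_le_wordSpan T R h'))
      rintro _ ⟨x, hx, rfl⟩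
      exact ⟨_, ⟨x, hx, rfl⟩, by simp⟩
  · refine sup_le ?_ (iSup_le fun i => ?_)
    · refine le_trans ?_ (map_le_wordSpan T R (α := []) (Nat.succ_pos n))
      intro x hx
      exact ⟨x, hx, rfl⟩
    · rw [wordSpan, Submodule.map_iSup]
      refine iSup_le fun α => ?_
      refine le_trans ?_ (map_le_wordSpan T R (α := i :: α.1) (by simpa using α.2))
      rintro _ ⟨_, ⟨x, hx, rfl⟩, rfl⟩
      exact ⟨x, hx, by simp⟩

instance wordSpan_finiteDimensional (T : Fin d → H →L[ℂ] H) (R : Submodule ℂ H)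
    [FiniteDimensional ℂ R] (n : ℕ) : FiniteDimensional ℂ (wordSpan T R n) := by
  induction n with
  | zero => rw [wordSpan_zero]; infer_instance
  | succ n ih => rw [wordSpan_succ]; infer_instance

lemma finrank_iSup_map_le (T : Fin d → H →L[ℂ] H) (N : Submodule ℂ H) [FiniteDimensional ℂ N] :
    Module.finrank ℂ (⨆ i, N.map (T i).toLinearMap : Submodule ℂ H) ≤ d * Module.finrank ℂ N := by
  have key : ∀ s : Finset (Fin d),
      FiniteDimensional ℂ (s.sup fun i => N.map (T i).toLinearMap : Submodule ℂ H) ∧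
      Module.finrank ℂ (s.sup fun i => N.map (T i).toLinearMap : Submodule ℂ H) ≤
        s.card * Module.finrank ℂ N := by
    intro s
    induction s using Finset.cons_induction with
    | empty =>
      rw [Finset.sup_empty]
      exact ⟨inferInstance, by simp⟩
    | cons a s ha ih =>
      have := ih.1
      rw [Finset.sup_cons, Finset.card_cons, add_mul, one_mul, add_comm]
      exact ⟨inferInstance, (Submodule.finrank_add_le_finrank_add_finrank _ _).trans
        (add_le_add (Submodule.finrank_map_le _ _) ih.2)⟩
  have := (key Finset.univ).2
  rwa [Finset.sup_univ_eq_iSup, Finset.card_univ, Fintype.card_fin] at this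

/-- Write M_{n+1} = M_n ⊕ N. The images T_i M_n already lie in M_{n+1}, so only the d images T_i N
can contribute to M_{n+2}. -/
lemma finrank_wordSpan_step (T : Fin d → H →L[ℂ] H) (R : Submodule ℂ H) [FiniteDimensional ℂ R]
    (n : ℕ) :
    (Module.finrank ℂ (wordSpan T R (n + 2)) : ℝ) - Module.finrank ℂ (wordSpan T R (n + 1)) ≤
      d * ((Module.finrank ℂ (wordSpan T R (n + 1)) : ℝ) - Module.finrank ℂ (wordSpan T R n)) := by
  set M := wordSpan T R
  set N : Submodule ℂ H := (M n)ᗮ ⊓ M (n + 1)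
  have : FiniteDimensional ℂ N := Submodule.finiteDimensional_of_le (inf_le_right : N ≤ M (n + 1))
  have hN : Module.finrank ℂ (M n) + Module.finrank ℂ N = Module.finrank ℂ (M (n + 1)) :=
    Submodule.finrank_add_inf_finrank_orthogonal (wordSpan_mono T R n.le_succ)
  have hsup : M (n + 1) ≤ M n ⊔ N :=
    (Submodule.sup_orthogonal_inf_of_hasOrthogonalProjection (wordSpan_mono T R n.le_succ)).ge
  have hle : M (n + 2) ≤ M (n + 1) ⊔ ⨆ i, N.map (T i).toLinearMap := by
    have h1 : M (n + 2) = R ⊔ ⨆ i, (M (n + 1)).map (T i).toLinearMap := wordSpan_succ T R (n + 1)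
    have h2 : M (n + 1) = R ⊔ ⨆ i, (M n).map (T i).toLinearMap := wordSpan_succ T R n
    rw [h1]
    refine sup_le (le_sup_of_le_left (h2 ▸ le_sup_left)) (iSup_le fun i => ?_)
    refine (Submodule.map_mono hsup).trans ?_
    rw [Submodule.map_sup]
    refine sup_le_sup ?_ (le_iSup (fun i => N.map (T i).toLinearMap) i)
    rw [h2]
    exact le_sup_of_le_right (le_iSup (fun i => (M n).map (T i).toLinearMap) i)
  have h3 : Module.finrank ℂ (M (n + 2)) ≤
      Module.finrank ℂ (M (n + 1)) + d * Module.finrank ℂ N :=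
    (Submodule.finrank_mono hle).trans ((Submodule.finrank_add_le_finrank_add_finrank _ _).trans
      (add_le_add le_rfl (finrank_iSup_map_le T N)))
  have h3' : (Module.finrank ℂ (M (n + 2)) : ℝ) ≤
      Module.finrank ℂ (M (n + 1)) + d * Module.finrank ℂ N := by exact_mod_cast h3
  have hN' : (Module.finrank ℂ (M n) : ℝ) + Module.finrank ℂ N = Module.finrank ℂ (M (n + 1)) := by
    exact_mod_cast hN
  rw [← hN', add_sub_cancel_left]
  linarith

/-- The dimension is the telescoping sum of its increments, starting from the zero space at n = 0.
-/
lemma exists_tendsto_finrank_wordSpan (hd : 0 < d) (T : Fin d → H →L[ℂ] H) (R : Submodule ℂ H)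
    [FiniteDimensional ℂ R] :
    ∃ l : ℝ, Tendsto (fun n => (Module.finrank ℂ (wordSpan T R n) : ℝ) / (geomSum d n : ℝ))
      atTop (𝓝 l) := by
  obtain ⟨l, hl⟩ := exists_tendsto_div_pow hd
    (c := fun n => (Module.finrank ℂ (wordSpan T R (n + 1)) : ℝ) -
      Module.finrank ℂ (wordSpan T R n))
    (fun n => sub_nonneg.mpr (by
      exact_mod_cast Submodule.finrank_mono (wordSpan_mono T R n.le_succ)))
    (fun n => finrank_wordSpan_step T R n)
  refine ⟨l, (tendsto_sum_div_geomSum hd hl).congr fun n => ?_⟩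
  rw [Finset.sum_range_sub (fun n => (Module.finrank ℂ (wordSpan T R n) : ℝ)) n, wordSpan_zero]
  simp

/-! ### Traces by degree -/

section DegTrace

variable {G : Type*} [NormedAddCommGroup G] [InnerProductSpace ℂ G] [CompleteSpace G]
  [FiniteDimensional ℂ G] {T : Fin d → H →L[ℂ] H} {X : G →L[ℂ] H}

/-- The number `∑_{|α| = n} ‖T_α X‖₂²`, the trace of `J* (P_n ⊗ 1) J`. -/
def degTrace (T : Fin d → H →L[ℂ] H) (X : G →L[ℂ] H) (n : ℕ) : ℝ :=
  ∑ α ∈ wordsOfLength d n, hsNormSq (wordOp T α ∘L X)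

lemma degTrace_succ_le (hT : ∀ i, ‖T i‖ ≤ 1) (n : ℕ) :
    degTrace T X (n + 1) ≤ d * degTrace T X n := by
  rw [degTrace, sum_wordsOfLength_succ]
  calc _ ≤ ∑ i : Fin d, degTrace T X n := Finset.sum_le_sum fun i _ =>
        Finset.sum_le_sum fun α _ => by
          rw [wordOp_cons, comp_assoc]
          exact hsNormSq_comp_le (hT i) _
    _ = _ := by simp

lemma exists_tendsto_degTrace (hd : 0 < d) (hT : ∀ i, ‖T i‖ ≤ 1) :
    ∃ l : ℝ, Tendsto (fun n => degTrace T X n / (d : ℝ) ^ n) atTop (𝓝 l) :=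
  exists_tendsto_div_pow hd (fun _ => Finset.sum_nonneg fun _ _ => hsNormSq_nonneg _)
    (degTrace_succ_le hT)

end DegTrace

variable [CompleteSpace H] {G : Type u} [NormedAddCommGroup G] [InnerProductSpace ℂ G]
  [CompleteSpace G]

/-- `J h = ∑ e_α ⊗ X* T_α* h`. -/
def IsPoissonType (T : Fin d → H →L[ℂ] H) (X : G →L[ℂ] H) (J : H →L[ℂ] Fock d G) : Prop :=
  ∀ h α, J h α = adjoint X (adjoint (wordOp T α) h)

variable {T : Fin d → H →L[ℂ] H} {X : G →L[ℂ] H} {J : H →L[ℂ] Fock d G}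

lemma isPoissonType_of_adjoint
    (h : ∀ α x, adjoint J (wordTensor α x) = wordOp T α (X x)) : IsPoissonType T X J := by
  intro y α
  refine ext_inner_left ℂ fun x => ?_
  rw [← inner_wordTensor, ← adjoint_inner_left J, h, adjoint_inner_right, adjoint_inner_right]

namespace IsPoissonType

lemma adjoint_comp_wordTensor (hJ : IsPoissonType T X J) (α : List (Fin d)) :
    J† ∘L wordTensor α = wordOp T α ∘L X := by
  ext x
  refine ext_inner_right ℂ fun h => ?_
  rw [comp_apply, comp_apply, adjoint_inner_left, inner_wordTensor, hJ, adjoint_inner_right,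
    adjoint_inner_right]

lemma wordTensor_adjoint_comp (hJ : IsPoissonType T X J) (α : List (Fin d)) :
    (wordTensor α)† ∘L J = (wordOp T α ∘L X)† := by
  rw [← hJ.adjoint_comp_wordTensor, adjoint_comp, adjoint_adjoint]

lemma range_adjoint_degLTProj (hJ : IsPoissonType T X J) (n : ℕ) :
    (J† ∘L degLTProj n).range = wordSpan T X.range n := by
  apply le_antisymm
  · rintro _ ⟨y, rfl⟩
    have h : (J† ∘L degLTProj n) y =
        ∑ k ∈ Finset.range n, ∑ α ∈ wordsOfLength d k, wordOp T α (X (y α)) := by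
      rw [degLTProj_eq_sum, comp_apply, sum_apply, map_sum]
      refine Finset.sum_congr rfl fun k _ => ?_
      rw [degProj_eq_sum, sum_apply, map_sum]
      refine Finset.sum_congr rfl fun α _ => ?_
      rw [comp_apply, adjoint_wordTensor]
      exact DFunLike.congr_fun (hJ.adjoint_comp_wordTensor α) (y α)
    refine (congrArg (· ∈ wordSpan T X.range n) h).mpr ?_
    refine Submodule.sum_mem _ fun k hk => Submodule.sum_mem _ fun α hα => ?_
    refine map_le_wordSpan T _ (α := α) ?_ ⟨_, ⟨y α, rfl⟩, rfl⟩
    rw [mem_wordsOfLength.mp hα]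
    exact Finset.mem_range.mp hk
  · refine iSup_le fun α => ?_
    rintro _ ⟨_, ⟨x, rfl⟩, rfl⟩
    refine ⟨wordTensor α.1 x, ?_⟩
    have h : degLTProj n (wordTensor α.1 x) = wordTensor α.1 x := by
      ext β
      rw [degLTProj, wordProj_apply]
      by_cases hβ : β = α.1
      · rw [if_pos (by rw [hβ]; exact α.2)]
      · rw [wordTensor_apply, if_neg hβ, ite_self]
    change adjoint J (degLTProj n (wordTensor α.1 x)) = _
    rw [h]
    exact DFunLike.congr_fun (hJ.adjoint_comp_wordTensor α.1) x

/-- An injective J preserves the dimension of the range of J*(P_{<n} ⊗ 1). -/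
lemma opRank_comp_adjoint_degLTProj (hJ : IsPoissonType T X J) (hinj : Function.Injective J)
    (n : ℕ) :
    opRank ((J ∘L J†) ∘L degLTProj n) = Module.finrank ℂ (wordSpan T X.range n) := by
  rw [opRank, ← hJ.range_adjoint_degLTProj, comp_assoc]
  change Module.finrank ℂ (LinearMap.range (J.toLinearMap ∘ₗ (J† ∘L degLTProj n).toLinearMap)) = _
  rw [LinearMap.range_comp]
  exact (Submodule.equivMapOfInjective J.toLinearMap hinj _).symm.finrank_eq

variable [FiniteDimensional ℂ G]

lemma opTrace_degProj (hJ : IsPoissonType T X J) (n : ℕ) :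
    opTrace (J† ∘L degProj n ∘L J) = (degTrace T X n : ℂ) := by
  have h : J† ∘L degProj n ∘L J =
      ∑ α ∈ wordsOfLength d n, (wordOp T α ∘L X) ∘L (wordOp T α ∘L X)† := by
    rw [degProj_eq_sum, finsetSum_comp, comp_finsetSum]
    refine Finset.sum_congr rfl fun α _ => ?_
    rw [comp_assoc, hJ.wordTensor_adjoint_comp, ← comp_assoc, hJ.adjoint_comp_wordTensor]
  rw [h, opTrace_sum_comp, degTrace, Complex.ofReal_sum]
  exact Finset.sum_congr rfl fun α _ => opTrace_adjoint_comp_self _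

lemma opTrace_degLTProj (hJ : IsPoissonType T X J) (n : ℕ) :
    opTrace (J† ∘L degLTProj n ∘L J) = ∑ k ∈ Finset.range n, (degTrace T X k : ℂ) := by
  -- Degrees and words are merged into one index set, so that the trace of a finite sum of operators
  -- factoring through G applies once.
  have h : J† ∘L degLTProj n ∘L J = ∑ p ∈ (Finset.range n).sigma fun k => wordsOfLength d k,
      (wordOp T p.2 ∘L X) ∘L (wordOp T p.2 ∘L X)† := by
    rw [degLTProj_eq_sum, finsetSum_comp, comp_finsetSum, Finset.sum_sigma]
    refine Finset.sum_congr rfl fun k _ => ?_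
    rw [degProj_eq_sum, finsetSum_comp, comp_finsetSum]
    refine Finset.sum_congr rfl fun α _ => ?_
    rw [comp_assoc, hJ.wordTensor_adjoint_comp, ← comp_assoc, hJ.adjoint_comp_wordTensor]
  rw [h, opTrace_sum_comp, Finset.sum_sigma]
  refine Finset.sum_congr rfl fun k _ => ?_
  rw [degTrace, Complex.ofReal_sum]
  exact Finset.sum_congr rfl fun α _ => opTrace_adjoint_comp_self _

/-- The compression of 1 - J J* to e_α ⊗ G is 1 - (T_α X)*(T_α X). -/
lemma opTrace_word_complement (hJ : IsPoissonType T X J) (α : List (Fin d)) :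
    opTrace ((wordTensor α)† ∘L ((1 - J ∘L J†) ∘L wordTensor α)) =
      (Module.finrank ℂ G : ℂ) - hsNormSq (wordOp T α ∘L X) := by
  rw [← opTrace_adjoint_comp_self, ← opTrace_one, ← opTrace_sub]
  congr 1
  rw [sub_comp, comp_sub, comp_assoc, ← comp_assoc _ J, hJ.wordTensor_adjoint_comp,
    hJ.adjoint_comp_wordTensor]
  congr 1
  ext x
  simp only [comp_apply, one_apply_eq_self, adjoint_wordTensor, wordTensor_apply, if_true]

lemma opTrace_complement_degProj (hJ : IsPoissonType T X J) (n : ℕ) :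
    opTrace ((1 - J ∘L J†) ∘L degProj n) =
      (Module.finrank ℂ G : ℂ) * (d : ℂ) ^ n - degTrace T X n := by
  have h : (1 - J ∘L J†) ∘L degProj n = ∑ α ∈ wordsOfLength d n,
      ((1 - J ∘L J†) ∘L wordTensor α) ∘L (wordTensor α)† := by
    rw [degProj_eq_sum, comp_finsetSum]
    rfl
  rw [h, opTrace_sum_comp, Finset.sum_congr rfl fun α _ => hJ.opTrace_word_complement α,
    Finset.sum_sub_distrib, degTrace, Complex.ofReal_sum]
  simp [card_wordsOfLength, mul_comm]

lemma opTrace_complement_degLTProj (hJ : IsPoissonType T X J) (n : ℕ) :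
    opTrace ((1 - J ∘L J†) ∘L degLTProj n) =
      ∑ k ∈ Finset.range n, ((Module.finrank ℂ G : ℂ) * (d : ℂ) ^ k - degTrace T X k) := by
  have h : (1 - J ∘L J†) ∘L degLTProj n =
      ∑ p ∈ (Finset.range n).sigma fun k => wordsOfLength d k,
      ((1 - J ∘L J†) ∘L wordTensor p.2) ∘L (wordTensor p.2)† := by
    rw [degLTProj_eq_sum, comp_finsetSum, Finset.sum_sigma]
    refine Finset.sum_congr rfl fun k _ => ?_
    rw [degProj_eq_sum, comp_finsetSum]
    rfl
  rw [h, opTrace_sum_comp, Finset.sum_sigma]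
  refine Finset.sum_congr rfl fun k _ => ?_
  rw [Finset.sum_congr rfl fun α _ => hJ.opTrace_word_complement α,
    Finset.sum_sub_distrib, degTrace, Complex.ofReal_sum]
  simp [card_wordsOfLength, mul_comm]

lemma opRank_adjoint_degLTProj_comp (hJ : IsPoissonType T X J) (n : ℕ) :
    opRank (J† ∘L degLTProj n ∘L J) = Module.finrank ℂ (wordSpan T X.range n) := by
  have hidem : (degLTProj n : Fock d G →L[ℂ] Fock d G) ∘L degLTProj n = degLTProj n := by
    ext f α
    simp only [degLTProj, comp_apply, wordProj_apply]
    split_ifs <;> rfl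
  have hself : (degLTProj n : Fock d G →L[ℂ] Fock d G)† = degLTProj n := by
    rw [degLTProj_eq_sum, map_sum]
    refine Finset.sum_congr rfl fun k _ => ?_
    rw [degProj_eq_sum, map_sum]
    refine Finset.sum_congr rfl fun α _ => ?_
    rw [adjoint_comp, adjoint_adjoint]
  set S : Fock d G →L[ℂ] H := J† ∘L degLTProj n with hS
  have hSS : J† ∘L degLTProj n ∘L J = S ∘L S† := by
    rw [hS, adjoint_comp, adjoint_adjoint, hself, comp_assoc,
      ← comp_assoc (degLTProj n) (degLTProj n) J, hidem]
  have hrS : S.range = wordSpan T X.range n := hJ.range_adjoint_degLTProj n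
  have : FiniteDimensional ℂ S.range := by rw [hrS]; infer_instance
  have hle : (S ∘L S†).range ≤ S.range := LinearMap.range_comp_le_range _ _
  have : FiniteDimensional ℂ (S ∘L S†).range := Submodule.finiteDimensional_of_le hle
  -- Both ranges are finite-dimensional, hence equal to their double orthogonal complements; it
  -- suffices that S S* and S* have the same kernel.
  have hr : (S ∘L S†).range = S.range := by
    rw [← Submodule.orthogonal_orthogonal (S ∘L S†).range, ← Submodule.orthogonal_orthogonal S.range,
      orthogonal_range, orthogonal_range, adjoint_comp, adjoint_adjoint, ker_self_comp_adjoint]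
  rw [opRank, hSS, ← hrS]
  exact congrArg (fun V : Submodule ℂ H => Module.finrank ℂ V) hr

end IsPoissonType

end PoissonType

/-! ### Row contractions -/

section Sqrt

variable {H : Type*} [NormedAddCommGroup H] [InnerProductSpace ℂ H] [CompleteSpace H]

lemma clm_sqrt_mul_sqrt {S : H →L[ℂ] H} (hS : 0 ≤ S) : CFC.sqrt S * CFC.sqrt S = S :=
  CFC.sqrt_mul_sqrt_self _ hS

lemma clm_sqrt_adjoint (S : H →L[ℂ] H) : (CFC.sqrt S)† = CFC.sqrt S :=
  (CFC.sqrt_nonneg _).isSelfAdjoint.adjoint_eq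

end Sqrt

section Rows

variable {d : ℕ} {H : Type*} [NormedAddCommGroup H] [InnerProductSpace ℂ H]

lemma rowOp_apply {H' : Type*} [NormedAddCommGroup H'] [InnerProductSpace ℂ H']
    (T : Fin d → H →L[ℂ] H') (x : Copies d H) : rowOp T x = ∑ i, T i (x i) := by
  simp [rowOp, sum_apply]

lemma inclCopy_apply (i j : Fin d) (h : H) : inclCopy i h j = if j = i then h else 0 := by
  simp [inclCopy]

lemma sum_inclCopy (x : Copies d H) : ∑ i, inclCopy i (x i) = x := by
  ext j
  simp [inclCopy_apply]

lemma rowOp_inclCopy {H' : Type*} [NormedAddCommGroup H'] [InnerProductSpace ℂ H']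
    (T : Fin d → H →L[ℂ] H') (i : Fin d) (h : H) : rowOp T (inclCopy i h) = T i h := by
  rw [rowOp_apply, Finset.sum_eq_single i]
  · simp [inclCopy_apply]
  · intro j _ hj
    simp [inclCopy_apply, hj]
  · simp

lemma inner_inclCopy (i : Fin d) (h : H) (x : Copies d H) :
    ⟪inclCopy i h, x⟫_ℂ = ⟪h, x i⟫_ℂ := by
  rw [PiLp.inner_apply, Finset.sum_eq_single i]
  · simp [inclCopy_apply]
  · intro j _ hj
    simp [inclCopy_apply, hj]
  · simp

variable [CompleteSpace H]

lemma adjoint_rowOp_apply {H' : Type*} [NormedAddCommGroup H'] [InnerProductSpace ℂ H']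
    [CompleteSpace H'] (T : Fin d → H →L[ℂ] H') (y : H') (i : Fin d) :
    adjoint (rowOp T) y i = adjoint (T i) y := by
  refine ext_inner_left ℂ fun h => ?_
  rw [← inner_inclCopy, adjoint_inner_right, rowOp_inclCopy, adjoint_inner_right]

/-- In this norm form contractivity passes from E to its blocks C and A. -/
lemma isRowContraction_iff {T : Fin d → H →L[ℂ] H} :
    IsRowContraction T ↔ ∀ h, ∑ i, ‖adjoint (T i) h‖ ^ 2 ≤ ‖h‖ ^ 2 := by
  constructor
  · intro hT h
    rw [← defectStar_sq hT h]
    have := sq_nonneg ‖defectStar T h‖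
    linarith
  · intro hT
    have hre : ∀ h, RCLike.re ⟪(1 - ∑ i, T i ∘L (T i)†) h, h⟫_ℂ =
        ‖h‖ ^ 2 - ∑ i, ‖adjoint (T i) h‖ ^ 2 := by
      intro h
      have h4 : ∀ i, RCLike.re ⟪T i (adjoint (T i) h), h⟫_ℂ = ‖adjoint (T i) h‖ ^ 2 := fun i => by
        rw [← adjoint_inner_right, inner_self_eq_norm_sq]
      simp only [sub_apply, one_apply_eq_self, sum_apply, comp_apply, inner_sub_left, sum_inner,
        map_sub, map_sum, h4, inner_self_eq_norm_sq]
    rw [IsRowContraction, ContinuousLinearMap.le_def, isPositive_def']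
    refine ⟨?_, fun h => ?_⟩
    · refine (IsSelfAdjoint.one _).sub (isSelfAdjoint_sum _ fun i _ => ?_)
      rw [isSelfAdjoint_iff', adjoint_comp, adjoint_adjoint]
    · rw [reApplyInnerSelf_apply, hre]
      exact sub_nonneg.mpr (hT h)

namespace IsRowContraction

variable {T : Fin d → H →L[ℂ] H}

lemma norm_le_one (hT : IsRowContraction T) (i : Fin d) : ‖T i‖ ≤ 1 := by
  rw [← LinearIsometryEquiv.norm_map adjoint (T i)]
  refine opNorm_le_bound _ zero_le_one fun h => ?_
  rw [one_mul]
  refine pow_le_pow_iff_left₀ (norm_nonneg _) (norm_nonneg _) two_ne_zero |>.mp ?_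
  exact (Finset.single_le_sum (f := fun i => ‖adjoint (T i) h‖ ^ 2) (fun _ _ => by positivity)
    (Finset.mem_univ i)).trans (isRowContraction_iff.mp hT h)

lemma norm_rowOp_le (hT : IsRowContraction T) (x : Copies d H) : ‖rowOp T x‖ ≤ ‖x‖ := by
  have h : ‖rowOp T‖ ≤ 1 := by
    rw [← LinearIsometryEquiv.norm_map adjoint (rowOp T)]
    refine opNorm_le_bound _ zero_le_one fun h => ?_
    rw [one_mul]
    refine pow_le_pow_iff_left₀ (norm_nonneg _) (norm_nonneg _) two_ne_zero |>.mp ?_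
    rw [PiLp.norm_sq_eq_of_L2]
    simp only [adjoint_rowOp_apply]
    exact isRowContraction_iff.mp hT h
  simpa using (rowOp T).le_of_opNorm_le h x

lemma inner_defect (hT : IsRowContraction T) (x y : Copies d H) :
    ⟪defect T x, defect T y⟫_ℂ = ⟪x, y⟫_ℂ - ⟪rowOp T x, rowOp T y⟫_ℂ := by
  have hpos : (0 : Copies d H →L[ℂ] Copies d H) ≤ 1 - (rowOp T)† ∘L rowOp T := by
    rw [ContinuousLinearMap.nonneg_iff_isPositive, isPositive_def']
    refine ⟨(IsSelfAdjoint.one _).sub ?_, fun x => ?_⟩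
    · rw [isSelfAdjoint_iff', adjoint_comp, adjoint_adjoint]
    · rw [reApplyInnerSelf_apply, sub_apply, inner_sub_left, comp_apply, adjoint_inner_left,
        one_apply_eq_self, map_sub, inner_self_eq_norm_sq, inner_self_eq_norm_sq]
      exact sub_nonneg.mpr (pow_le_pow_left₀ (norm_nonneg _) (hT.norm_rowOp_le x) 2)
  have hsq : defect T * defect T = 1 - (rowOp T)† ∘L rowOp T := clm_sqrt_mul_sqrt hpos
  have hadj : (defect T)† = defect T := clm_sqrt_adjoint _
  rw [← adjoint_inner_right, hadj, ← mul_apply_eq_comp, hsq, sub_apply, inner_sub_right, comp_apply,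
    adjoint_inner_right, one_apply_eq_self]

end IsRowContraction

lemma defect_adjoint (T : Fin d → H →L[ℂ] H) : (defect T)† = defect T :=
  clm_sqrt_adjoint _

/-- If `A` is completely non-coisometric then the maps `h ↦ D_{*,A} A_α* h` separate points. -/
lemma IsCNC.eq_zero {A : Fin d → H →L[ℂ] H} (hA : IsRowContraction A) (hcnc : IsCNC A) {h : H}
    (hh : ∀ α, defectStar A (adjoint (wordOp A α) h) = 0) : h = 0 := by
  refine hcnc h fun n => ?_
  rw [sum_ofFn n fun α => ‖adjoint (wordOp A α) h‖ ^ 2]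
  induction n generalizing h with
  | zero => simp [wordsOfLength, ← ContinuousLinearMap.star_eq_adjoint]
  | succ n ih =>
    have hnil : defectStar A h = 0 := by
      simpa [← ContinuousLinearMap.star_eq_adjoint] using hh []
    have hcons : ∀ i α, adjoint (wordOp A (i :: α)) h =
        adjoint (wordOp A α) (adjoint (A i) h) := fun i α => by
      rw [wordOp_cons, adjoint_comp]; rfl
    -- With D_{*,A} h = 0 the defect identity loses nothing: ∑ ‖A_i* h‖² = ‖h‖². Each A_i* h
    -- satisfies the same hypothesis, so this can be iterated.
    have hsq := defectStar_sq hA h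
    rw [hnil, norm_zero, zero_pow two_ne_zero, zero_add] at hsq
    rw [sum_wordsOfLength_succ, ← hsq]
    refine Finset.sum_congr rfl fun i _ => ?_
    simp only [hcons]
    exact ih fun α => by rw [← hcons]; exact hh (i :: α)

end Rows

/-! ### Poisson kernels and finite-dimensional defect spaces -/

section FiniteDefect

variable {d : ℕ} {H : Type u} [NormedAddCommGroup H] [InnerProductSpace ℂ H] [CompleteSpace H]

lemma rowPoissonKernel_isPoissonType {T : Fin d → H →L[ℂ] H} (hT : IsRowContraction T) :
    IsPoissonType T ((defectStarTo T)†) (rowPoissonKernel T) := by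
  intro h α
  rw [rowPoissonKernel, dif_pos hT, adjoint_adjoint]
  rfl

variable {T : Fin d → H →L[ℂ] H} [FiniteDimensional ℂ (LinearMap.range (defect T).toLinearMap)]

lemma defectSpace_eq_range : defectSpace T = LinearMap.range (defect T).toLinearMap :=
  IsClosed.submodule_topologicalClosure_eq (Submodule.closed_of_finiteDimensional _)

instance defectSpace_finiteDimensional : FiniteDimensional ℂ (defectSpace T) := by
  rw [defectSpace_eq_range]; infer_instance

lemma finrank_defectSpace : Module.finrank ℂ (defectSpace T) = opRank (defect T) := by
  rw [opRank, defectSpace_eq_range]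

/-- The range of D_T is closed, being finite-dimensional, so every vector of the defect space has
the form D_T h; formulas need only be checked on these. -/
lemma defectTo_surjective : Function.Surjective (defectTo T) := by
  rintro ⟨x, hx⟩
  rw [defectSpace_eq_range] at hx
  obtain ⟨y, rfl⟩ := hx
  exact ⟨y, rfl⟩

end FiniteDefect

lemma withLp_prod_ext {X Y : Type*} {x y : WithLp 2 (X × Y)} (h₁ : x.fst = y.fst)
    (h₂ : x.snd = y.snd) : x = y :=
  WithLp.ofLp_injective 2 (Prod.ext h₁ h₂)

section Lifting

variable {d : ℕ} {HC HA : Type u}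
  [NormedAddCommGroup HC] [InnerProductSpace ℂ HC]
  [NormedAddCommGroup HA] [InnerProductSpace ℂ HA]
  {C : Fin d → HC →L[ℂ] HC} {B : Fin d → HC →L[ℂ] HA} {A : Fin d → HA →L[ℂ] HA}

/-! ### Block tuples and dilations in coordinates -/

@[simp] lemma blockTuple_fst (i : Fin d) (x : WithLp 2 (HC × HA)) :
    (blockTuple C B A i x).fst = C i x.fst := rfl

@[simp] lemma blockTuple_snd (i : Fin d) (x : WithLp 2 (HC × HA)) :
    (blockTuple C B A i x).snd = B i x.fst + A i x.snd := rfl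

variable [CompleteSpace HC]

@[simp] lemma mid_fst (i : Fin d) (x : MidSpace C) : (mid C i x).fst = C i x.fst := rfl

@[simp] lemma mid_snd (i : Fin d) (x : MidSpace C) :
    (mid C i x).snd = vacuum (defectTo C (inclCopy i x.fst)) + creation i x.snd := rfl

variable [CompleteSpace HA]

lemma adjoint_blockTuple_fst (i : Fin d) (x : WithLp 2 (HC × HA)) :
    (adjoint (blockTuple C B A i) x).fst = adjoint (C i) x.fst + adjoint (B i) x.snd := by
  refine ext_inner_left ℂ fun h => ?_
  have := adjoint_inner_right (blockTuple C B A i) (WithLp.toLp 2 (h, 0)) x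
  rw [WithLp.prod_inner_apply, WithLp.prod_inner_apply] at this
  simpa [inner_add_right, adjoint_inner_right] using this

lemma adjoint_blockTuple_snd (i : Fin d) (x : WithLp 2 (HC × HA)) :
    (adjoint (blockTuple C B A i) x).snd = adjoint (A i) x.snd := by
  refine ext_inner_left ℂ fun h => ?_
  have := adjoint_inner_right (blockTuple C B A i) (WithLp.toLp 2 (0, h)) x
  rw [WithLp.prod_inner_apply, WithLp.prod_inner_apply] at this
  simpa [adjoint_inner_right] using this

lemma IsRowContraction.of_blockTuple_left (hE : IsRowContraction (blockTuple C B A)) :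
    IsRowContraction C := by
  refine isRowContraction_iff.mpr fun h => ?_
  have := isRowContraction_iff.mp hE (WithLp.toLp 2 (h, 0))
  simpa [WithLp.prod_norm_sq_eq_of_L2, adjoint_blockTuple_fst, adjoint_blockTuple_snd] using this

lemma IsRowContraction.of_blockTuple_right (hE : IsRowContraction (blockTuple C B A)) :
    IsRowContraction A := by
  refine isRowContraction_iff.mpr fun h => ?_
  have := isRowContraction_iff.mp hE (WithLp.toLp 2 (0, h))
  simp only [WithLp.prod_norm_sq_eq_of_L2, adjoint_blockTuple_fst, adjoint_blockTuple_snd] at this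
  refine le_trans (Finset.sum_le_sum fun i _ => ?_) (this.trans_eq (by simp))
  simp

lemma IsLiftingContraction.apply_eq {γ : defectStarSpace A →L[ℂ] defectSpace C}
    (hγ : IsLiftingContraction C B A γ)(i : Fin d) (h : HC) :
    B i h = adjoint (γ ∘L defectStarTo A) (defectTo C (inclCopy i h)) := by
  refine ext_inner_left ℂ fun k => ?_
  rw [adjoint_inner_right, ← rowOp_inclCopy B, ← adjoint_inner_left, hγ.2, ← adjoint_inner_right,
    defect_adjoint]
  rfl

/-! ### The characteristic function and the Poisson kernel -/

namespace DilationSplitting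

variable {K : Type v} [NormedAddCommGroup K] [InnerProductSpace ℂ K] (S : DilationSplitting C B A K)

/-- The component in `Γ ⊗ 𝒟_C` of `W`. -/
def fockPart : MidSpace (blockTuple C B A) →L[ℂ] Fock d (defectSpace C) :=
  WithLp.sndL 2 ℂ HC (Fock d (defectSpace C)) ∘L WithLp.fstL 2 ℂ (MidSpace C) K ∘L
    S.W.toContinuousLinearEquiv.toContinuousLinearMap

/-- The operator `P_{Γ ⊗ 𝒟_C} W|_{H_A}`. -/
def poisson : HA →L[ℂ] Fock d (defectSpace C) :=
  S.fockPart ∘L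
    (WithLp.prodContinuousLinearEquiv 2 ℂ (WithLp 2 (HC × HA))
      (Fock d (defectSpace (blockTuple C B A)))).symm.toContinuousLinearMap ∘L
    ContinuousLinearMap.inl ℂ (WithLp 2 (HC × HA)) (Fock d (defectSpace (blockTuple C B A))) ∘L
    (WithLp.prodContinuousLinearEquiv 2 ℂ HC HA).symm.toContinuousLinearMap ∘L
    ContinuousLinearMap.inr ℂ HC HA

lemma fockPart_apply (z : MidSpace (blockTuple C B A)) : S.fockPart z = (S.W z).fst.snd := rfl

lemma poisson_apply (h : HA) :
    S.poisson h = S.fockPart (WithLp.toLp 2 (WithLp.toLp 2 (0, h), 0)) := rfl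

lemma charFun_apply (x : Fock d (defectSpace (blockTuple C B A))) :
    S.charFun x = S.fockPart (WithLp.toLp 2 (0, x)) := rfl

/-- The preimage under `W` of an element of `Γ ⊗ 𝒟_C`. -/
def pullback (y : Fock d (defectSpace C)) : MidSpace (blockTuple C B A) :=
  S.W.symm (WithLp.toLp 2 (WithLp.toLp 2 (0, y), 0))

lemma W_pullback (y : Fock d (defectSpace C)) :
    S.W (S.pullback y) = WithLp.toLp 2 (WithLp.toLp 2 (0, y), 0) :=
  S.W.apply_symm_apply _

/-- As W is unitary, `pullback` is the adjoint of `fockPart`. Its components are therefore the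
adjoints of the restrictions of `fockPart` to the three summands: 0, J* and M*. -/
lemma inner_pullback (y : Fock d (defectSpace C)) (z : MidSpace (blockTuple C B A)) :
    ⟪S.pullback y, z⟫_ℂ = ⟪y, S.fockPart z⟫_ℂ := by
  refine (LinearIsometryEquiv.inner_map_map (𝕜 := ℂ) (E := MidSpace (blockTuple C B A))
    (E' := WithLp 2 (MidSpace C × K)) S.W (S.pullback y) z).symm.trans ?_
  rw [W_pullback, fockPart_apply, WithLp.prod_inner_apply,
    WithLp.prod_inner_apply]
  simp

lemma pullback_fst_fst (y : Fock d (defectSpace C)) : (S.pullback y).fst.fst = 0 := by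
  refine ext_inner_right ℂ fun h => ?_
  have := S.inner_pullback y (WithLp.toLp 2 (WithLp.toLp 2 (h, 0), 0))
  rw [fockPart_apply, S.fixes] at this
  rw [WithLp.prod_inner_apply, WithLp.prod_inner_apply] at this
  simpa using this

lemma pullback_fst_snd (y : Fock d (defectSpace C)) :
    (S.pullback y).fst.snd = adjoint S.poisson y := by
  refine ext_inner_right ℂ fun h => ?_
  have := S.inner_pullback y (WithLp.toLp 2 (WithLp.toLp 2 (0, h), 0))
  rw [adjoint_inner_left, poisson_apply, ← this]
  rw [WithLp.prod_inner_apply, WithLp.prod_inner_apply]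
  simp

lemma pullback_snd (y : Fock d (defectSpace C)) :
    (S.pullback y).snd = adjoint S.charFun y := by
  refine ext_inner_right ℂ fun x => ?_
  have := S.inner_pullback y (WithLp.toLp 2 (0, x))
  rw [adjoint_inner_left, charFun_apply, ← this]
  rw [WithLp.prod_inner_apply]
  simp

/-- The Γ ⊗ 𝒟_C part of W W* = 1; the summand H_C does not contribute because W fixes it. -/
lemma charFun_comp_adjoint :
    S.charFun ∘L (S.charFun)† = 1 - S.poisson ∘L (S.poisson)† := by
  rw [eq_sub_iff_add_eq]
  ext1 y
  change S.charFun (adjoint S.charFun y) + S.poisson (adjoint S.poisson y) = y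
  rw [← pullback_snd, ← pullback_fst_snd, charFun_apply, poisson_apply, ← map_add]
  have h : WithLp.toLp 2 (0, (S.pullback y).snd) +
      WithLp.toLp 2 (WithLp.toLp 2 (0, (S.pullback y).fst.snd), 0) = S.pullback y := by
    refine withLp_prod_ext (withLp_prod_ext ?_ ?_) ?_
    · simp [S.pullback_fst_fst]
    · simp
    · simp
  rw [h, fockPart_apply, W_pullback]
  rfl

/-- On 0 ⊕ y the dilation of C acts as L_i ⊗ 1. After pulling back by W the H_C component is 0, so
B_i drops out and A_i remains. -/
lemma adjoint_poisson_creation (i : Fin d) (y : Fock d (defectSpace C)) :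
    adjoint S.poisson (creation i y) = A i (adjoint S.poisson y) := by
  have h : S.pullback (creation i y) = mid (blockTuple C B A) i (S.pullback y) := by
    apply S.W.injective
    rw [S.intertwines, W_pullback, W_pullback]
    refine withLp_prod_ext (withLp_prod_ext ?_ ?_) ?_ <;> simp
  rw [← pullback_fst_snd, h, mid_fst, blockTuple_snd, S.pullback_fst_fst, map_zero, zero_add,
    pullback_fst_snd]

/-- The vacuum vector is V_i^C h - C_i h. Its pullback is V_i^E h - C_i h, whose H_A component is
B_i h. -/
lemma adjoint_poisson_vacuum (i : Fin d) (h : HC) :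
    adjoint S.poisson (vacuum (defectTo C (inclCopy i h))) = B i h := by
  have hp : S.pullback (vacuum (defectTo C (inclCopy i h))) =
      mid (blockTuple C B A) i (WithLp.toLp 2 (WithLp.toLp 2 (h, 0), 0)) -
        WithLp.toLp 2 (WithLp.toLp 2 (C i h, 0), 0) := by
    apply S.W.injective
    rw [map_sub, S.intertwines, W_pullback, S.fixes, S.fixes]
    refine withLp_prod_ext (withLp_prod_ext ?_ ?_) ?_ <;> simp
  rw [← pullback_fst_snd, hp]
  simp

lemma poisson_isPoissonType (hC : Function.Surjective (defectTo C))
    {γ : defectStarSpace A →L[ℂ] defectSpace C} (hγ : IsLiftingContraction C B A γ) :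
    IsPoissonType A ((γ ∘L defectStarTo A)†) S.poisson := by
  have hvac : ∀ x, adjoint S.poisson (vacuum x) = adjoint (γ ∘L defectStarTo A) x := by
    intro x
    obtain ⟨h, rfl⟩ := hC x
    rw [← sum_inclCopy h]
    simp only [map_sum, S.adjoint_poisson_vacuum, hγ.apply_eq]
  refine isPoissonType_of_adjoint fun α x => ?_
  induction α with
  | nil => exact hvac x
  | cons i α ih =>
    rw [wordOp_cons, comp_apply, ← ih, ← adjoint_poisson_creation]
    rfl

end DilationSplitting

end Lifting

/-! ### The minimal isometric dilation is a row isometry -/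

section RowIsometry

variable {d : ℕ} {G : Type u} [NormedAddCommGroup G] [InnerProductSpace ℂ G]

lemma inner_vacuum (g : G) (f : Fock d G) : ⟪vacuum g, f⟫_ℂ = ⟪g, f []⟫_ℂ :=
  inner_wordTensor [] g f

lemma inner_creation (i j : Fin d) (f g : Fock d G) :
    ⟪creation i f, creation j g⟫_ℂ = if i = j then ⟪f, g⟫_ℂ else 0 := by
  have h : innerSL ℂ (creation i f) ∘L creation j = if i = j then innerSL ℂ f else 0 := by
    refine clm_ext_wordTensor fun α x => ?_
    change ⟪creation i f, wordTensor (j :: α) x⟫_ℂ = _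
    rw [← inner_conj_symm, inner_wordTensor, creation_cons]
    by_cases hij : i = j
    · subst hij
      rw [if_pos rfl, if_pos rfl, innerSL_apply_apply, ← inner_conj_symm f, inner_wordTensor]
    · rw [if_neg (Ne.symm hij), if_neg hij]
      simp
  have h' := DFunLike.congr_fun h g
  rw [comp_apply, innerSL_apply_apply] at h'
  rw [h']
  split_ifs <;> simp

/-- The tuple `V` consists of isometries with pairwise orthogonal ranges. -/
def IsRowIsometry {H : Type*} [NormedAddCommGroup H] [InnerProductSpace ℂ H]
    (V : Fin d → H →L[ℂ] H) : Prop :=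
  ∀ i j x y, ⟪V i x, V j y⟫_ℂ = if i = j then ⟪x, y⟫_ℂ else 0

/-- The defect term restores exactly what T loses, and vacuum vectors are orthogonal to the ranges
of the creation operators. -/
lemma IsRowContraction.mid_isRowIsometry {H : Type u} [NormedAddCommGroup H]
    [InnerProductSpace ℂ H] [CompleteSpace H] {T : Fin d → H →L[ℂ] H} (hT : IsRowContraction T) :
    IsRowIsometry (mid T) := by
  intro i j x y
  have h1 : ⟪defectTo T (inclCopy i x.fst), defectTo T (inclCopy j y.fst)⟫_ℂ =
      (if i = j then ⟪x.fst, y.fst⟫_ℂ else 0) - ⟪T i x.fst, T j y.fst⟫_ℂ := by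
    rw [← rowOp_inclCopy T, ← rowOp_inclCopy T]
    refine (hT.inner_defect _ _).trans ?_
    rw [inner_inclCopy, inclCopy_apply]
    split_ifs <;> simp
  have h2 : ⟪creation i x.snd, vacuum (defectTo T (inclCopy j y.fst))⟫_ℂ = 0 := by
    rw [← inner_conj_symm, inner_vacuum, creation_nil, inner_zero_right, map_zero]
  rw [WithLp.prod_inner_apply, WithLp.prod_inner_apply]
  change ⟪T i x.fst, T j y.fst⟫_ℂ +
    ⟪vacuum (defectTo T (inclCopy i x.fst)) + creation i x.snd,
      vacuum (defectTo T (inclCopy j y.fst)) + creation j y.snd⟫_ℂ =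
    if i = j then ⟪x.fst, y.fst⟫_ℂ + ⟪x.snd, y.snd⟫_ℂ else 0
  rw [inner_add_left, inner_add_right, inner_add_right, h2, inner_creation, inner_vacuum,
    inner_vacuum, creation_nil, inner_zero_right, vacuum_nil, h1]
  split_ifs <;> ring

end RowIsometry

/-! ### Embedding the minimal isometric dilation in an isometric dilation -/

section Embedding

variable {d : ℕ} {HC : Type u} [NormedAddCommGroup HC] [InnerProductSpace ℂ HC]
  {H : Type*} [NormedAddCommGroup H] [InnerProductSpace ℂ H]
  (C : Fin d → HC →L[ℂ] HC) (V : Fin d → H →L[ℂ] H) (J : HC →ₗᵢ[ℂ] H)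

/-- The operator `h ↦ ∑ Vᵢ J hᵢ - J ∑ Cᵢ hᵢ` onto the wandering space. -/
def wandering : Copies d HC →L[ℂ] H :=
  rowOp (fun i => V i ∘L J.toContinuousLinearMap) - J.toContinuousLinearMap ∘L rowOp C

variable {C V J}

lemma wandering_apply (h : Copies d HC) :
    wandering C V J h = ∑ i, V i (J (h i)) - J (rowOp C h) := by
  rw [wandering, sub_apply, rowOp_apply]
  rfl

lemma wandering_inclCopy (i : Fin d) (h : HC) :
    wandering C V J (inclCopy i h) = V i (J h) - J (C i h) := by
  rw [wandering, sub_apply, rowOp_inclCopy, comp_apply (J.toContinuousLinearMap) (rowOp C),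
    rowOp_inclCopy]
  rfl

variable [CompleteSpace HC]

variable (C V J) in
/-- The row isometry `V` on a space that contains a copy `J` of `HC` is a dilation of `C`:
`Vᵢ* J = J Cᵢ*`. -/
structure IsIsometricDilation : Prop where
  isometry : IsRowIsometry V
  coinvariant : ∀ i h z, ⟪J h, V i z⟫_ℂ = ⟪J (adjoint (C i) h), z⟫_ℂ

namespace IsIsometricDilation

lemma inner_incl_row (hV : IsIsometricDilation C V J) (x : HC) (h : Copies d HC) :
    ⟪J x, ∑ i, V i (J (h i))⟫_ℂ = ⟪x, rowOp C h⟫_ℂ := by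
  rw [inner_sum, rowOp_apply, inner_sum]
  refine Finset.sum_congr rfl fun i _ => ?_
  rw [hV.coinvariant, J.inner_map_map, adjoint_inner_left]

lemma inner_incl_wandering (hV : IsIsometricDilation C V J) (x : HC) (h : Copies d HC) :
    ⟪J x, wandering C V J h⟫_ℂ = 0 := by
  rw [wandering_apply, inner_sub_right, hV.inner_incl_row, J.inner_map_map, sub_self]

/-- If z is orthogonal to J, the right side vanishes; this is what makes the vectors wandering. -/
lemma inner_wandering_isometry (hV : IsIsometricDilation C V J) (h : Copies d HC) (i : Fin d) (z : H) :
    ⟪wandering C V J h, V i z⟫_ℂ =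
      ⟪J (h i), z⟫_ℂ - ⟪J (adjoint (C i) (rowOp C h)), z⟫_ℂ := by
  rw [wandering_apply, inner_sub_left, hV.coinvariant, sum_inner]
  simp [hV.isometry _ _ _ _]

/-- Both squared norms equal ‖h‖² - ‖C h‖². Hence D_C h determines the wandering vector
isometrically. -/
lemma norm_wandering (hV : IsIsometricDilation C V J) (hC : IsRowContraction C) (h : Copies d HC) :
    ‖wandering C V J h‖ = ‖defectTo C h‖ := by
  have h1 : ⟪wandering C V J h, wandering C V J h⟫_ℂ = ⟪defect C h, defect C h⟫_ℂ := by
    rw [hC.inner_defect]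
    nth_rw 2 [wandering_apply]
    rw [inner_sub_right, inner_sum, ← inner_conj_symm _ (J _), hV.inner_incl_wandering, map_zero,
      sub_zero]
    simp only [hV.inner_wandering_isometry, J.inner_map_map, adjoint_inner_left]
    rw [Finset.sum_sub_distrib, PiLp.inner_apply, ← inner_sum, ← rowOp_apply]
  rw [inner_self_eq_norm_sq_to_K, inner_self_eq_norm_sq_to_K] at h1
  have h2 : ‖wandering C V J h‖ ^ 2 = ‖defect C h‖ ^ 2 := by exact_mod_cast h1
  exact (sq_eq_sq₀ (norm_nonneg _) (norm_nonneg _)).mp h2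

lemma inner_incl_word_wandering (hV : IsIsometricDilation C V J) (α : List (Fin d)) (x : HC) (h : Copies d HC) :
    ⟪J x, wordOp V α (wandering C V J h)⟫_ℂ = 0 := by
  induction α generalizing x with
  | nil => exact hV.inner_incl_wandering x h
  | cons i α ih => rw [wordOp_cons, comp_apply, hV.coinvariant, ih]

/-- Common first letters cancel because V is a row isometry. Either different letters remain, with
orthogonal ranges, or a wandering vector faces V_i of another translate, which is orthogonal to J.
-/
lemma inner_word_wandering (hV : IsIsometricDilation C V J) {α β : List (Fin d)}
    (hαβ : α ≠ β) (h k : Copies d HC) :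
    ⟪wordOp V α (wandering C V J h), wordOp V β (wandering C V J k)⟫_ℂ = 0 := by
  have h0 : ∀ i (γ : List (Fin d)) (h k : Copies d HC),
      ⟪wandering C V J h, V i (wordOp V γ (wandering C V J k))⟫_ℂ = 0 := by
    intro i γ h k
    rw [hV.inner_wandering_isometry, hV.inner_incl_word_wandering, hV.inner_incl_word_wandering,
      sub_zero]
  induction α generalizing β with
  | nil =>
    rcases β with _ | ⟨j, β⟩
    · exact absurd rfl hαβ
    · rw [wordOp_cons]
      exact h0 j β h k
  | cons i α ih =>
    rcases β with _ | ⟨j, β⟩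
    · rw [wordOp_cons, ← inner_conj_symm]
      exact (congrArg _ (h0 i α k h)).trans (map_zero _)
    · rw [wordOp_cons, wordOp_cons, comp_apply, comp_apply, hV.isometry]
      split_ifs with hij
      · subst hij
        exact ih fun h' => hαβ (by rw [h'])
      · rfl

lemma norm_wordOp (hV : IsIsometricDilation C V J) (α : List (Fin d)) (x : H) :
    ‖wordOp V α x‖ = ‖x‖ := by
  induction α with
  | nil => rfl
  | cons i α ih =>
    rw [wordOp_cons, comp_apply, ← ih]
    have := hV.isometry i i (wordOp V α x) (wordOp V α x)
    rw [if_pos rfl, inner_self_eq_norm_sq_to_K, inner_self_eq_norm_sq_to_K] at this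
    have h2 : ‖V i (wordOp V α x)‖ ^ 2 = ‖wordOp V α x‖ ^ 2 := by exact_mod_cast this
    exact (sq_eq_sq₀ (norm_nonneg _) (norm_nonneg _)).mp h2

lemma exists_wandering_isometry (hV : IsIsometricDilation C V J) (hC : IsRowContraction C)
    (hsurj : Function.Surjective (defectTo C)) :
    ∃ w : defectSpace C →ₗᵢ[ℂ] H, ∀ h, w (defectTo C h) = wandering C V J h := by
  -- Any linear right inverse will do: by `norm_wandering` the wandering vector depends only on D_C
  -- h, and continuity follows from the norm equality.
  obtain ⟨s, hs⟩ := (defectTo C).toLinearMap.exists_rightInverse_of_surjective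
    (LinearMap.range_eq_top.mpr hsurj)
  have hs' : ∀ x, defectTo C (s x) = x := fun x => LinearMap.congr_fun hs x
  refine ⟨⟨(wandering C V J).toLinearMap ∘ₗ s, fun x => ?_⟩, fun h => ?_⟩
  · change ‖wandering C V J (s x)‖ = ‖x‖
    rw [hV.norm_wandering hC, hs']
  · change wandering C V J (s (defectTo C h)) = wandering C V J h
    rw [← sub_eq_zero, ← map_sub, ← norm_eq_zero, hV.norm_wandering hC, map_sub, hs', sub_self,
      norm_zero]

lemma exists_fock_isometry [CompleteSpace H] (hV : IsIsometricDilation C V J) (hC : IsRowContraction C)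
    (hsurj : Function.Surjective (defectTo C)) :
    ∃ F : Fock d (defectSpace C) →ₗᵢ[ℂ] H,
      ∀ α h, F (wordTensor α (defectTo C h)) = wordOp V α (wandering C V J h) := by
  classical
  obtain ⟨w, hw⟩ := hV.exists_wandering_isometry hC hsurj
  let f : List (Fin d) → defectSpace C →ₗᵢ[ℂ] H := fun α =>
    ⟨(wordOp V α).toLinearMap ∘ₗ w.toLinearMap, fun x =>
      (hV.norm_wordOp α (w x)).trans (w.norm_map x)⟩
  have hf : OrthogonalFamily ℂ (fun _ : List (Fin d) => defectSpace C) f := by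
    intro α β hαβ x y
    obtain ⟨h, rfl⟩ := hsurj x
    obtain ⟨k, rfl⟩ := hsurj y
    change ⟪wordOp V α (w (defectTo C h)), wordOp V β (w (defectTo C k))⟫_ℂ = 0
    rw [hw, hw, hV.inner_word_wandering hαβ]
  refine ⟨hf.linearIsometry, fun α h => ?_⟩
  rw [wordTensor_eq_single, ← hw]
  exact hf.linearIsometry_apply_single (defectTo C h)

/-- The minimal isometric dilation of `C` embeds in every isometric dilation, with a range that
reduces the dilation. -/
lemma exists_embedding [CompleteSpace H] (hV : IsIsometricDilation C V J) (hC : IsRowContraction C)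
    (hsurj : Function.Surjective (defectTo C)) :
    ∃ U : MidSpace C →ₗᵢ[ℂ] H, (∀ h, U (WithLp.toLp 2 (h, 0)) = J h) ∧
      (∀ i x, U (mid C i x) = V i (U x)) ∧
      ∀ i z, (∀ x, ⟪U x, z⟫_ℂ = 0) → ∀ x, ⟪U x, V i z⟫_ℂ = 0 := by
  obtain ⟨F, hF⟩ := hV.exists_fock_isometry hC hsurj
  have hext : ∀ z : H, (∀ α h, ⟪z, wordOp V α (wandering C V J h)⟫_ℂ = 0) → ∀ y, ⟪z, F y⟫_ℂ = 0 := by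
    intro z hz y
    have : innerSL ℂ z ∘L F.toContinuousLinearMap = 0 := by
      refine clm_ext_wordTensor fun α x => ?_
      obtain ⟨h, rfl⟩ := hsurj x
      change ⟪z, F (wordTensor α (defectTo C h))⟫_ℂ = 0
      rw [hF, hz]
    exact DFunLike.congr_fun this y
  have horth : ∀ h y, ⟪J h, F y⟫_ℂ = 0 := fun h =>
    hext _ fun α k => hV.inner_incl_word_wandering α h k
  have hcre : ∀ i y, F (creation i y) = V i (F y) := by
    intro i
    have : F.toContinuousLinearMap ∘L creation i = V i ∘L F.toContinuousLinearMap := by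
      refine clm_ext_wordTensor fun α x => ?_
      obtain ⟨h, rfl⟩ := hsurj x
      change F (wordTensor (i :: α) (defectTo C h)) = V i (F (wordTensor α (defectTo C h)))
      rw [hF, hF, wordOp_cons, comp_apply]
    exact DFunLike.congr_fun this
  let U₀ : MidSpace C →ₗ[ℂ] H :=
    { toFun := fun x => J x.fst + F x.snd
      map_add' := fun x y => by simp only [WithLp.add_fst, WithLp.add_snd, map_add]; abel
      map_smul' := fun c x => by
        simp only [WithLp.smul_fst, WithLp.smul_snd, map_smul, smul_add, RingHom.id_apply] }
  have hU₀ : ∀ x, ‖U₀ x‖ = ‖x‖ := by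
    intro x
    refine (sq_eq_sq₀ (norm_nonneg _) (norm_nonneg _)).mp ?_
    rw [WithLp.prod_norm_sq_eq_of_L2, ← J.norm_map x.fst, ← F.norm_map x.snd, sq, sq, sq]
    exact norm_add_sq_eq_norm_sq_add_norm_sq_of_inner_eq_zero _ _ (horth _ _)
  refine ⟨⟨U₀, hU₀⟩, fun h => ?_, fun i x => ?_, fun i z hz => ?_⟩
  · change J h + F 0 = J h
    rw [map_zero, add_zero]
  · change J (C i x.fst) + F (vacuum (defectTo C (inclCopy i x.fst)) + creation i x.snd) =
      V i (J x.fst + F x.snd)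
    have h1 : F (vacuum (defectTo C (inclCopy i x.fst))) = V i (J x.fst) - J (C i x.fst) :=
      (hF [] _).trans (wandering_inclCopy i x.fst)
    rw [map_add, map_add, hcre, h1]
    abel
  · have hJz : ∀ h, ⟪J h, z⟫_ℂ = 0 := fun h => by
      have := hz (WithLp.toLp 2 (h, 0))
      change ⟪J h + F 0, z⟫_ℂ = 0 at this
      rwa [map_zero, add_zero] at this
    have hFz : ∀ y, ⟪F y, z⟫_ℂ = 0 := fun y => by
      have := hz (WithLp.toLp 2 (0, y))
      change ⟪J 0 + F y, z⟫_ℂ = 0 at this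
      rwa [map_zero, zero_add] at this
    intro x
    change ⟪J x.fst + F x.snd, V i z⟫_ℂ = 0
    rw [inner_add_left, hV.coinvariant, hJz, zero_add, ← inner_conj_symm, hext, map_zero]
    intro α h
    rw [← inner_conj_symm, map_eq_zero]
    -- For the empty word, z is orthogonal to J. Otherwise the row isometry strips the first letter
    -- or gives 0, and z is orthogonal to F.
    rcases α with _ | ⟨j, α⟩
    · change ⟪wandering C V J h, V i z⟫_ℂ = 0
      rw [hV.inner_wandering_isometry, hJz, hJz, sub_zero]
    · rw [wordOp_cons, comp_apply, hV.isometry, ← hF, hFz, ite_self]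

/-- K is the orthogonal complement of the embedded minimal dilation. It is invariant under V, so Y
is the restriction of V to K. -/
lemma exists_splitting {H : Type u} [NormedAddCommGroup H] [InnerProductSpace ℂ H]
    [CompleteSpace H] {V : Fin d → H →L[ℂ] H} {J : HC →ₗᵢ[ℂ] H} (hV : IsIsometricDilation C V J)
    (hC : IsRowContraction C) (hsurj : Function.Surjective (defectTo C)) :
    ∃ (K : Type u) (_ : NormedAddCommGroup K) (_ : InnerProductSpace ℂ K) (_ : CompleteSpace K)
      (W : H ≃ₗᵢ[ℂ] WithLp 2 (MidSpace C × K)) (Y : Fin d → K →L[ℂ] K),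
      (∀ i x, W (V i x) = WithLp.toLp 2 (mid C i (W x).fst, Y i (W x).snd)) ∧
        ∀ h, W (J h) = WithLp.toLp 2 (WithLp.toLp 2 (h, 0), 0) := by
  obtain ⟨U, hUJ, hUmid, hUorth⟩ := hV.exists_embedding hC hsurj
  have hcomplete : IsComplete (LinearMap.range U.toLinearMap : Set (H)) := by
    rw [LinearMap.coe_range]
    exact U.isometry.isUniformInducing.isComplete_range
  have : CompleteSpace (LinearMap.range U.toLinearMap) := hcomplete.completeSpace_coe
  set K := (LinearMap.range U.toLinearMap)ᗮ with hK
  have hmem : ∀ {z}, z ∈ K ↔ ∀ x, ⟪U x, z⟫_ℂ = 0 := by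
    intro z
    rw [hK, Submodule.mem_orthogonal]
    exact ⟨fun h x => h _ ⟨x, rfl⟩, by rintro h _ ⟨x, rfl⟩; exact h x⟩
  let R₀ : WithLp 2 (MidSpace C × K) →ₗ[ℂ] H :=
    { toFun := fun p => U p.fst + (p.snd : H)
      map_add' := fun x y => by
        simp only [WithLp.add_fst, WithLp.add_snd, map_add, Submodule.coe_add]; abel
      map_smul' := fun c x => by
        simp only [WithLp.smul_fst, WithLp.smul_snd, map_smul, smul_add, RingHom.id_apply,
          Submodule.coe_smul] }
  have hR₀ : ∀ p, ‖R₀ p‖ = ‖p‖ := by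
    intro p
    refine (sq_eq_sq₀ (norm_nonneg _) (norm_nonneg _)).mp ?_
    rw [WithLp.prod_norm_sq_eq_of_L2, ← U.norm_map p.fst, ← Submodule.norm_coe, sq, sq, sq]
    exact norm_add_sq_eq_norm_sq_add_norm_sq_of_inner_eq_zero _ _ (hmem.mp p.snd.2 _)
  have hsurjR : Function.Surjective (⟨R₀, hR₀⟩ : WithLp 2 (MidSpace C × K) →ₗᵢ[ℂ] _) := by
    intro z
    obtain ⟨_, ⟨m, rfl⟩, k, hk, rfl⟩ :=
      (LinearMap.range U.toLinearMap).exists_add_mem_mem_orthogonal z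
    exact ⟨WithLp.toLp 2 (m, ⟨k, hk⟩), rfl⟩
  let R := LinearIsometryEquiv.ofSurjective
    (⟨R₀, hR₀⟩ : WithLp 2 (MidSpace C × K) →ₗᵢ[ℂ] H) hsurjR
  have hR : ∀ p, R p = U p.fst + (p.snd : H) := fun p => rfl
  have hVK : ∀ i (k : K), (V i ∘L K.subtypeL) k ∈ K := fun i k =>
    hmem.mpr (hUorth i k (hmem.mp k.2))
  refine ⟨K, inferInstance, inferInstance, inferInstance, R.symm,
    fun i => (V i ∘L K.subtypeL).codRestrict K (hVK i),
    fun i x => ?_, fun h => ?_⟩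
  · obtain ⟨p, rfl⟩ := R.surjective x
    rw [LinearIsometryEquiv.symm_apply_eq, LinearIsometryEquiv.symm_apply_apply, hR, hR, map_add]
    exact congrArg (· + _) (hUmid i p.fst).symm
  · rw [LinearIsometryEquiv.symm_apply_eq, hR]
    change J h = U (WithLp.toLp 2 (h, 0)) + 0
    rw [add_zero, hUJ]

end IsIsometricDilation

end Embedding

/-! ### Existence of the characteristic function -/

section Existence

variable {d : ℕ} {HC HA : Type u}
  [NormedAddCommGroup HC] [InnerProductSpace ℂ HC] [CompleteSpace HC]
  [NormedAddCommGroup HA] [InnerProductSpace ℂ HA] [CompleteSpace HA]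
  {C : Fin d → HC →L[ℂ] HC} {B : Fin d → HC →L[ℂ] HA} {A : Fin d → HA →L[ℂ] HA}

/-- The zero in the upper right corner of E makes H_C coinvariant, so the dilation of E is an
isometric dilation of C. -/
lemma exists_dilationSplitting (hE : IsRowContraction (blockTuple C B A))
    (hsurj : Function.Surjective (defectTo C)) :
    ∃ (K : Type u) (_ : NormedAddCommGroup K) (_ : InnerProductSpace ℂ K) (_ : CompleteSpace K),
      Nonempty (DilationSplitting C B A K) := by
  let J : HC →ₗᵢ[ℂ] MidSpace (blockTuple C B A) :=
    { toFun := fun h => WithLp.toLp 2 (WithLp.toLp 2 (h, 0), 0)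
      map_add' := fun x y => by
        refine withLp_prod_ext (withLp_prod_ext ?_ ?_) ?_ <;> simp
      map_smul' := fun c x => by
        refine withLp_prod_ext (withLp_prod_ext ?_ ?_) ?_ <;> simp
      norm_map' := fun x => by simp }
  have hJ : IsIsometricDilation (H := MidSpace (blockTuple C B A)) C (mid (blockTuple C B A)) J := by
    refine ⟨hE.mid_isRowIsometry, fun i h z => ?_⟩
    simp only [WithLp.prod_inner_apply]
    change ⟪h, C i z.fst.fst⟫_ℂ + ⟪(0 : HA), _⟫_ℂ + ⟪(0 : Fock d _), _⟫_ℂ =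
      ⟪adjoint (C i) h, z.fst.fst⟫_ℂ + ⟪(0 : HA), _⟫_ℂ + ⟪(0 : Fock d _), _⟫_ℂ
    rw [adjoint_inner_left]
    simp only [inner_zero_left]
  obtain ⟨K, i₁, i₂, i₃, W, Y, hW, hWJ⟩ := hJ.exists_splitting hE.of_blockTuple_left hsurj
  exact ⟨K, i₁, i₂, i₃, ⟨⟨W, Y, hW, hWJ⟩⟩⟩

end Existence

end RowLifting

end

/-! ### The main theorem -/

set_option maxHeartbeats 1000000 in
open RowLifting in
theorem theorem6p1p1 {d : ℕ} (hd : 0 < d) {HC HA : Type u}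
    [NormedAddCommGroup HC] [InnerProductSpace ℂ HC] [CompleteSpace HC]
    [NormedAddCommGroup HA] [InnerProductSpace ℂ HA] [CompleteSpace HA]
    (C : Fin d → HC →L[ℂ] HC) (B : Fin d → HC →L[ℂ] HA) (A : Fin d → HA →L[ℂ] HA)
    (γ : defectStarSpace A →L[ℂ] defectSpace C)
    (hE : IsReducedLifting C B A γ) (hγ : Isometry γ)
    (hfin : FiniteDimensional ℂ (LinearMap.range (defect C).toLinearMap)) :
    -- the limits that define the two invariants of `A` exist
    Tendsto (fun n : ℕ =>
        opTrace ((rowPoissonKernel A)† ∘L degLTProj n ∘L rowPoissonKernel A) / (geomSum d n : ℂ))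
      atTop (𝓝 (curvature A : ℂ)) ∧
    Tendsto (fun n : ℕ =>
        opTrace ((rowPoissonKernel A)† ∘L degProj n ∘L rowPoissonKernel A) / (d : ℂ) ^ n)
      atTop (𝓝 (curvature A : ℂ)) ∧
    Tendsto (fun n : ℕ =>
        (opRank ((rowPoissonKernel A)† ∘L degLTProj n ∘L rowPoissonKernel A) : ℝ) / (geomSum d n : ℝ))
      atTop (𝓝 (eulerChar A)) ∧
    -- the characteristic function exists
    (∃ (K : Type u) (_ : NormedAddCommGroup K) (_ : InnerProductSpace ℂ K) (_ : CompleteSpace K),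
      Nonempty (DilationSplitting C B A K)) ∧
    -- the invariants in terms of the characteristic function
    ∀ (K : Type u) [NormedAddCommGroup K] [InnerProductSpace ℂ K] [CompleteSpace K]
      (S : DilationSplitting C B A K),
      (∃ l : ℂ, Tendsto (fun n : ℕ =>
          opTrace (S.charFun ∘L (S.charFun)† ∘L degLTProj n) / (geomSum d n : ℂ)) atTop (𝓝 l) ∧
        Tendsto (fun n : ℕ =>
          opTrace (S.charFun ∘L (S.charFun)† ∘L degProj n) / (d : ℂ) ^ n) atTop (𝓝 l) ∧
        (curvature A : ℂ) = (opRank (defect C) : ℂ) - l) ∧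
      Tendsto (fun n : ℕ =>
          (opRank ((1 - S.charFun ∘L (S.charFun)†) ∘L degLTProj n) : ℝ) / (geomSum d n : ℝ))
        atTop (𝓝 (eulerChar A)) := by
  have hEc := hE.rowContraction
  have hA : IsRowContraction A := hEc.of_blockTuple_right
  have hsurj : Function.Surjective (defectTo C) := defectTo_surjective
  let γ' : defectStarSpace A →ₗᵢ[ℂ] defectSpace C :=
    ⟨γ.toLinearMap, (AddMonoidHomClass.isometry_iff_norm γ).mp hγ⟩
  -- γ embeds 𝒟_{*,A} in the finite-dimensional space 𝒟_C.
  have : FiniteDimensional ℂ (defectStarSpace A) :=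
    FiniteDimensional.of_injective γ.toLinearMap hγ.injective
  have hγγ : γ† ∘L γ = 1 := (norm_map_iff_adjoint_comp_self γ).mp γ'.norm_map
  have hX : (γ ∘L defectStarTo A)† = (defectStarTo A)† ∘L γ† := adjoint_comp _ _
  have hγsurj : Function.Surjective (γ†) := fun x => ⟨γ x, DFunLike.congr_fun hγγ x⟩
  have hrange : ((γ ∘L defectStarTo A)†).range = ((defectStarTo A)†).range := by
    rw [hX]
    exact LinearMap.range_comp_of_range_eq_top _ (LinearMap.range_eq_top.mpr hγsurj)
  have htrace : ∀ n, degTrace A ((γ ∘L defectStarTo A)†) n =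
      degTrace A ((defectStarTo A)†) n := fun n =>
    Finset.sum_congr rfl fun α _ => by rw [hX, ← comp_assoc, hsNormSq_comp_adjoint hγγ]
  have hK := rowPoissonKernel_isPoissonType hA
  obtain ⟨l, hl⟩ := exists_tendsto_degTrace (X := (defectStarTo A)†) hd hA.norm_le_one
  obtain ⟨r, hr⟩ := exists_tendsto_finrank_wordSpan hd A ((defectStarTo A)†).range
  have hlsum := tendsto_sum_div_geomSum hd hl
  -- `limUnder` takes the value of a limit once convergence is known.
  have hcurv : curvature A = l := by
    refine Tendsto.limUnder_eq (hlsum.congr fun n => ?_)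
    rw [hK.opTrace_degLTProj, ← Complex.ofReal_sum, Complex.ofReal_re]
  have heuler : eulerChar A = r := by
    refine Tendsto.limUnder_eq (hr.congr fun n => ?_)
    rw [hK.opRank_adjoint_degLTProj_comp]
  have hlC : Tendsto (fun n => (degTrace A ((defectStarTo A)†) n : ℂ) / (d : ℂ) ^ n)
      atTop (𝓝 (l : ℂ)) :=
    ((Complex.continuous_ofReal.tendsto l).comp hl).congr fun n => by simp
  rw [hcurv, heuler]
  refine ⟨?_, ?_, ?_, ?_, ?_⟩
  · simp only [hK.opTrace_degLTProj]
    exact tendsto_sum_div_geomSum hd hlC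
  · simpa only [hK.opTrace_degProj] using hlC
  · simpa only [hK.opRank_adjoint_degLTProj_comp] using hr
  · exact exists_dilationSplitting hEc hsurj
  · intro K _ _ _ S
    have hJ := S.poisson_isPoissonType hsurj hE.contraction
    -- J h = 0 forces γ D_{*,A} A_α* h = 0 for all α; γ is injective and A completely
    -- non-coisometric.
    have hinj : Function.Injective S.poisson := by
      refine (injective_iff_map_eq_zero S.poisson).mpr fun h hh => ?_
      refine hE.cnc.eq_zero hA fun α => ?_
      have h0 : γ (defectStarTo A (adjoint (wordOp A α) h)) = 0 := by
        have := hJ h α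
        rw [hh, adjoint_adjoint] at this
        exact this.symm
      exact congrArg Subtype.val (hγ.injective (h0.trans (map_zero γ).symm))
    have hdC : (d : ℂ) ≠ 0 := by exact_mod_cast hd.ne'
    have hlim : Tendsto (fun n => ((opRank (defect C) : ℂ) * (d : ℂ) ^ n -
        degTrace A ((defectStarTo A)†) n) / (d : ℂ) ^ n) atTop
        (𝓝 ((opRank (defect C) : ℂ) - l)) := by
      refine (hlC.const_sub (opRank (defect C) : ℂ)).congr fun n => ?_
      rw [sub_div, mul_div_cancel_right₀ _ (pow_ne_zero n hdC)]
    refine ⟨⟨(opRank (defect C) : ℂ) - l, ?_, ?_, by ring⟩, ?_⟩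
    · refine (tendsto_sum_div_geomSum hd hlim).congr fun n => ?_
      rw [← comp_assoc, S.charFun_comp_adjoint, hJ.opTrace_complement_degLTProj,
        finrank_defectSpace]
      simp only [htrace]
    · refine hlim.congr fun n => ?_
      rw [← comp_assoc, S.charFun_comp_adjoint, hJ.opTrace_complement_degProj,
        finrank_defectSpace, htrace]
    · refine hr.congr fun n => ?_
      rw [S.charFun_comp_adjoint, sub_sub_cancel, hJ.opRank_comp_adjoint_degLTProj hinj, hrange]
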